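/- \textbf{Setting.} For $n\ge 0$ let $\mathcal H_n$ be the fermionic Fock space over $\mathbb C^n$, with annihilation operators $c_1,\dots,c_n$, number operator $N=\sum_i c_i^*c_i$ and Majorana operators $\gamma_i=c_i+c_i^*$, $\gamma_{i+n}=-i(c_i-c_i^*)$ for $1\le i\le n$. A state is a positive operator of trace one. A Gaussian state is a state of the form $e^{-\beta H}/\operatorname{Tr}e^{-\beta H}$ with $\beta\in\mathbb R$ and $H=\sum_{i,j}T_{ij}\gamma_i\gamma_j$ self-adjoint; a quasi-free state is a limit of Gaussian states. Let $\mathcal H_S=\mathcal H_L$ (system) and $\mathcal H_B=\mathcal H_K$ (bath unit), with Majorana operators $\gamma^S_i$ $(i\le 2L)$ and $\gamma^B_j$ $(j\le 2K)$. Regard them as operators on $\mathcal H_S\otimes\mathcal H_B$ by one of the two identifications \[ E_{SB}:\ \gamma^S_i\mapsto\gamma^S_i\otimes 1,\ \ \gamma^B_j\mapsto(-1)^{N_S}\otimes\gamma^B_j ,\qquad E_{BS}:\ \gamma^S_i\mapsto\gamma^S_i\otimes(-1)^{N_B},\ \ \gamma^B_j\mapsto 1\otimes\gamma^B_j . \]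 Let $T_S=iR_S$ and $T_B=iR_B$ with $R_S,R_B$ real antisymmetric matrices of sizes $2L\times 2L$ and $2K\times 2K$, let $\Theta=iW$ with $W$ a real $2L\times 2K$ matrix, and let $\omega$ be a quasi-free state on $\mathcal H_B$. Put \[ H_S=\tfrac12\sum_{i,j}(T_S)_{ij}\gamma^S_i\gamma^S_j,\qquad H_B=\tfrac12\sum_{i,j}(T_B)_{ij}\gamma^B_i\gamma^B_j,\qquad V=\sum_{i,j}\Theta_{ij}\gamma^S_i\gamma^B_j , \] and, for $\tau>0$, $H_\tau=H_S+\tau^{-1/2}V+H_B$ and $L_\tau(\rho)=\operatorname{Tr}_{\mathcal H_B}\!\big(e^{-i\tau H_\tau}(\rho\otimes\omega)e^{i\tau H_\tau}\big)$. For every $t\ge0$ the limit $\Lambda^t=\lim_{\tau\to0^+}L_\tau^{\lfloor t/\tau\rfloor}$ exists. A state $\sigma$ on $\mathcal H_S$ is stationary if $\Lambda^t\sigma=\sigma$ for all $t\ge 0$. Let \[ V(T_S,\Theta)=\operatorname{Span}\Big(\bigcup_{k=0}^{2L}\operatorname{Ran}\big(T_S^{\,k}\,\Theta\big)\Big)\subset\mathbb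 C^{2L}. \] \textbf{Theorem.} The following three conditions are equivalent. (1') For every initial state $\rho_S(0)$ on $\mathcal H_S$, $\rho_S(t)=\Lambda^t\rho_S(0)$ converges, as $t\to\infty$, to some stationary state (which may depend on $\rho_S(0)$ and need not be quasi-free). (2') $\ker\Theta^*$ contains eigenvectors of $T_S$ for at most one eigenvalue: there is at most one $\mu\in\mathbb C$ such that $\ker\Theta^*\cap\ker(T_S-\mu)\ne\{0\}$. (3') The orthogonal complement of $V(T_S,\Theta)$ is contained in a single eigenspace of $T_S$: there is $\mu\in\mathbb C$ with $T_Sx=\mu x$ for all $x\in V(T_S,\Theta)^\perp$ (in particular this holds if $V(T_S,\Theta)^\perp=\{0\}$). -/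

import Mathlib

open scoped Topology Kronecker ComplexOrder

namespace FermionicRI

/-! ### Fermionic Fock space with `n` modes -/

/-- Operators on the fermionic space over `ℂⁿ`, as matrices in the orthonormal occupation basis:
the basis vector `|u₁, …, uₙ⟩` is indexed by the set of occupied modes `{i | uᵢ = 1}`. -/
abbrev Op (n : ℕ) := Matrix (Finset (Fin n)) (Finset (Fin n)) ℂ

/-- Indices of the Majorana basis of the complex phase space: `inl i` is `i` and `inr i` is
`i + n`, for `i = 1, …, n`. -/
abbrev Phase (n : ℕ) := Fin n ⊕ Fin n

/-- The annihilation operator `cᵢ |u⟩ = δ_{uᵢ,1} (∏_{k<i} (-1)^{u_k}) |u₁, …, uᵢ - 1, …, uₙ⟩`. -/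
noncomputable def annihilation {n : ℕ} (i : Fin n) : Op n :=
  Matrix.of fun s t =>
    if i ∈ t ∧ s = t.erase i then (-1 : ℂ) ^ (t.filter (fun k => k < i)).card else 0

/-- The Majorana operators `γᵢ = cᵢ + cᵢ*` and `γ_{i+n} = -i (cᵢ - cᵢ*)`. -/
noncomputable def majorana {n : ℕ} : Phase n → Op n
  | Sum.inl i => annihilation i + (annihilation i).conjTranspose
  | Sum.inr i => (-Complex.I) • (annihilation i - (annihilation i).conjTranspose)

/-- The parity operator `(-1)^N`; the number operator `N = ∑ cᵢ* cᵢ` is diagonal and counts the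
occupied modes. -/
noncomputable def parity (n : ℕ) : Op n :=
  Matrix.diagonal fun s => (-1 : ℂ) ^ s.card

/-- The quadratic operator `F* T F = ∑ T_{ij} γᵢ γⱼ`, `T` being written in the Majorana basis. -/
noncomputable def quadratic {n : ℕ} (T : Matrix (Phase n) (Phase n) ℂ) : Op n :=
  ∑ i, ∑ j, T i j • (majorana i * majorana j)

/-- A quadratic Hamiltonian: a self-adjoint operator of the form `F* T F`. -/
def IsQuadraticHamiltonian {n : ℕ} (H : Op n) : Prop :=
  H.IsHermitian ∧ ∃ T : Matrix (Phase n) (Phase n) ℂ, H = quadratic T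

/-- A state (density matrix): a positive operator of trace one. -/
def IsState {n : ℕ} (ρ : Op n) : Prop :=
  ρ.PosSemidef ∧ ρ.trace = 1

/-- A Gaussian state: `exp (-β H) / Z` with `H` a quadratic Hamiltonian and `Z = tr exp (-β H)`. -/
def IsGaussian {n : ℕ} (ρ : Op n) : Prop :=
  ∃ (β : ℝ) (H : Op n), IsQuadraticHamiltonian H ∧
    ρ = (NormedSpace.exp ((-β : ℂ) • H)).trace⁻¹ • NormedSpace.exp ((-β : ℂ) • H)

/-- A quasi-free state: a limit of Gaussian states. -/
def IsQuasiFree {n : ℕ} (ρ : Op n) : Prop :=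
  ρ ∈ closure {σ : Op n | IsGaussian σ}

/-! ### The composite of a system (`L` modes) and a bath unit (`K` modes) -/

/-- Operators on `ℋ_S ⊗ ℋ_B`. -/
abbrev BiOp (L K : ℕ) :=
  Matrix (Finset (Fin L) × Finset (Fin K)) (Finset (Fin L) × Finset (Fin K)) ℂ

/-- The two identifications of the algebra of the fermionic space over `ℂᴸ ⊕ ℂᴷ` with
`𝓑(ℋ_S) ⊗ 𝓑(ℋ_B)`:
`E_SB` sends `γ^S` to `γ^S ⊗ 1` and `γ^B` to `(-1)^{N_S} ⊗ γ^B`;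
`E_BS` sends `γ^S` to `γ^S ⊗ (-1)^{N_B}` and `γ^B` to `1 ⊗ γ^B`. -/
inductive Identification : Type
  | SB : Identification
  | BS : Identification

/-- The image in `𝓑(ℋ_S) ⊗ 𝓑(ℋ_B)` of the Majorana operators of the system. -/
noncomputable def systemMajorana {L K : ℕ} (E : Identification) (i : Phase L) : BiOp L K :=
  match E with
  | Identification.SB => majorana i ⊗ₖ (1 : Op K)
  | Identification.BS => majorana i ⊗ₖ parity K

/-- The image in `𝓑(ℋ_S) ⊗ 𝓑(ℋ_B)` of the Majorana operators of the bath unit. -/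
noncomputable def bathMajorana {L K : ℕ} (E : Identification) (j : Phase K) : BiOp L K :=
  match E with
  | Identification.SB => parity L ⊗ₖ majorana j
  | Identification.BS => (1 : Op L) ⊗ₖ majorana j

/-- The partial trace over the bath unit. -/
def partialTrace {L K : ℕ} (A : BiOp L K) : Op L :=
  Matrix.of fun s t => ∑ b, A (s, b) (t, b)

/-! ### Repeated interactions -/

/-- The data of a fermionic repeated interaction process, in the Majorana bases: the matrices
`T_S = i R_S`, `T_B = i R_B`, `Θ = i W` and the quasi-free state `ω` of a bath unit, together with
the chosen identification. -/
structure Model (L K : ℕ) where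
  /-- `T_S = i RS` -/
  RS : Matrix (Phase L) (Phase L) ℝ
  /-- `T_B = i RB` -/
  RB : Matrix (Phase K) (Phase K) ℝ
  /-- `Θ = i W` -/
  W : Matrix (Phase L) (Phase K) ℝ
  /-- the state of each bath unit -/
  ω : Op K
  /-- the identification of the composite system with a tensor product -/
  E : Identification
  RS_antisymm : RS.transpose = -RS
  RB_antisymm : RB.transpose = -RB
  ω_quasiFree : IsQuasiFree ω

namespace Model

variable {L K : ℕ} (m : Model L K)

/-- The matrix `T_S` in the Majorana basis. -/
noncomputable def TS : Matrix (Phase L) (Phase L) ℂ := m.RS.map fun x => Complex.I * (x : ℂ)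

/-- The matrix `T_B` in the Majorana basis. -/
noncomputable def TB : Matrix (Phase K) (Phase K) ℂ := m.RB.map fun x => Complex.I * (x : ℂ)

/-- The matrix `Θ` in the Majorana bases. -/
noncomputable def Θ : Matrix (Phase L) (Phase K) ℂ := m.W.map fun x => Complex.I * (x : ℂ)

/-- The Hamiltonian `H_S = ½ F_S* T_S F_S`, acting on `ℋ_S ⊗ ℋ_B`. -/
noncomputable def systemHamiltonian : BiOp L K :=
  (1 / 2 : ℂ) • ∑ i, ∑ j, m.TS i j • (systemMajorana m.E i * systemMajorana m.E j)

/-- The Hamiltonian `H_B = ½ F_B* T_B F_B`, acting on `ℋ_S ⊗ ℋ_B`. -/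
noncomputable def bathHamiltonian : BiOp L K :=
  (1 / 2 : ℂ) • ∑ i, ∑ j, m.TB i j • (bathMajorana m.E i * bathMajorana m.E j)

/-- The interaction `V = F_S* Θ F_B`. -/
noncomputable def interaction : BiOp L K :=
  ∑ i, ∑ j, m.Θ i j • (systemMajorana m.E i * bathMajorana m.E j)

/-- The Hamiltonian `H_S + λ V + H_B` of an interaction of duration `τ`, with `λ = 1 / √τ`. -/
noncomputable def totalHamiltonian (τ : ℝ) : BiOp L K :=
  m.systemHamiltonian + ((1 / √τ : ℝ) : ℂ) • m.interaction + m.bathHamiltonian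

/-- The effect on the system of one interaction of duration `τ`:
`L_τ(ρ) = Tr_B (e^{-iτH} (ρ ⊗ ω) e^{iτH})`. -/
noncomputable def step (τ : ℝ) (ρ : Op L) : Op L :=
  partialTrace
    (NormedSpace.exp ((-(Complex.I * (τ : ℂ))) • m.totalHamiltonian τ) * (ρ ⊗ₖ m.ω) *
      NormedSpace.exp ((Complex.I * (τ : ℂ)) • m.totalHamiltonian τ))

/-- `Λ` is the continuous-time limit of the repeated interaction process:
`Λᵗ = lim_{τ → 0⁺} L_τ^⌊t/τ⌋` for all `t ≥ 0`. -/
def IsContinuousTimeLimit (Λ : ℝ → Op L → Op L) : Prop :=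
  ∀ t : ℝ, 0 ≤ t → ∀ ρ : Op L,
    Filter.Tendsto (fun τ : ℝ => (m.step τ)^[⌊t / τ⌋₊] ρ) (𝓝[>] 0) (𝓝 (Λ t ρ))

/-- `T_S` as an operator on `ℂ^{2L}`. -/
noncomputable def opTS :
    EuclideanSpace ℂ (Phase L) →ₗ[ℂ] EuclideanSpace ℂ (Phase L) :=
  Matrix.toEuclideanLin m.TS

/-- The subspace `ker Θ*` of `ℂ^{2L}`. -/
noncomputable def kerΘstar : Submodule ℂ (EuclideanSpace ℂ (Phase L)) :=
  LinearMap.ker (Matrix.toEuclideanLin m.Θ.conjTranspose)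

/-- `V(T_S, Θ)`: the span of the ranges of `T_S^k Θ` for `k = 0, …, 2L`. -/
noncomputable def kalmanSpace : Submodule ℂ (EuclideanSpace ℂ (Phase L)) :=
  ⨆ k ∈ Finset.range (2 * L + 1), LinearMap.range (Matrix.toEuclideanLin (m.TS ^ k * m.Θ))

end Model

/-- A stationary state of the evolution `Λ`. -/
def IsStationaryState {L : ℕ} (Λ : ℝ → Op L → Op L) (σ : Op L) : Prop :=
  IsState σ ∧ ∀ t : ℝ, 0 ≤ t → Λ t σ = σ

end FermionicRI

open FermionicRI

/-! Set s = √τ. Then -iτH_τ is s times a multiple of V plus s² times a multiple of H_S + H_B. The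
terms of order s vanish because ω commutes with parity and V is linear in the bath fields. Hence L_τ
= 1 + τM + o(τ) (`stepCLM_isLittleO`), and L_τ^⌊t/τ⌋ tends to exp(tM) (`tendsto_pow_floor_exp`).
Everything then depends on the spectrum of M.

On observables, left and twisted right multiplication by the fields combine into lowering maps D_i
and their Hilbert–Schmidt adjoints C_i, which satisfy the canonical anticommutation relations. In
these terms the dual of M is ∑ X_ij C_i D_j + ∑ Y_ij D_i D_j with X = -2R_S - 2WWᵀ
(`trace_mul_generator`); the bath state enters only through Y.

Sufficiency. Since M preserves states, exp(tM) is bounded, so it converges once M has no nonzero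
imaginary eigenvalue (`tendsto_exp_of_bounded`). The Y term lowers the degree in the D_i, so the
top-degree part z of an eigenvector of the dual is an eigenvector of K = ∑ X_ij C_i D_j. If the
eigenvalue is imaginary, the real part of ⟨z, Kz⟩ forces Wᵀ D z = 0, and commuting D with K gives Wᵀ
R_S^n D z = 0 for all n. The orthogonal complement of the Kalman space is closed under complex
conjugation, and a real eigenvector of i times a real antisymmetric matrix has eigenvalue 0; so if
the complement lies in one eigenspace, R_S vanishes on it (`RSc_mulVec_eq_zero`). Then R_S D z = 0,
Kz = 0, and the eigenvalue is 0 (`eigenvalue_eq_zero_of_re_eq_zero`).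

Necessity. If T_S x = μx and Θ*x = 0, the field ∑ x_i α_i is an eigenvector of the dual with
eigenvalue 2iμ, so its expectation rotates without damping. Convergence of all states forces μ = 0
(`eq_zero_of_convergence`).

The equivalence of the two algebraic conditions is the spectral decomposition of T_S on the
complement, which is invariant (`subsingleton_iff_kalmanSpace_orthogonal_le`). -/

namespace FermionicRI

/-! ### The Kalman space -/

namespace Model

variable {L K : ℕ} (m : Model L K)

/-- The matrix `R_S` with complex entries. -/
noncomputable def RSc : Matrix (Phase L) (Phase L) ℂ := m.RS.map (fun x => (x : ℂ))

/-- The matrix `W` with complex entries. -/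
noncomputable def Wc : Matrix (Phase L) (Phase K) ℂ := m.W.map (fun x => (x : ℂ))

lemma TS_eq : m.TS = Complex.I • m.RSc := by
  ext i j; simp [TS, RSc]

lemma Θ_eq : m.Θ = Complex.I • m.Wc := by
  ext i j; simp [Θ, Wc]

lemma RSc_transpose : m.RSc.transpose = -m.RSc := by
  ext i j
  have := congrFun (congrFun m.RS_antisymm i) j
  simp only [Matrix.transpose_apply, Matrix.neg_apply] at this
  simp [RSc, this]

lemma RSc_conjTranspose : m.RSc.conjTranspose = -m.RSc := by
  rw [← m.RSc_transpose]
  ext i j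
  simp [RSc]

lemma Wc_conjTranspose : m.Wc.conjTranspose = m.Wc.transpose := by
  ext i j
  simp [Wc]

lemma TS_isHermitian : m.TS.IsHermitian := by
  simp [Matrix.IsHermitian, TS_eq, Matrix.conjTranspose_smul, RSc_conjTranspose]

lemma Θ_conjTranspose : m.Θ.conjTranspose = (-Complex.I) • m.Wc.transpose := by
  simp [Θ_eq, Matrix.conjTranspose_smul, Wc_conjTranspose]

lemma opTS_apply (x : EuclideanSpace ℂ (Phase L)) :
    m.opTS x = WithLp.toLp 2 (m.TS.mulVec x.ofLp) := by
  simp [opTS, Matrix.toLpLin_apply]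

lemma mem_kerΘstar (x : EuclideanSpace ℂ (Phase L)) :
    x ∈ m.kerΘstar ↔ m.Wc.transpose.mulVec x.ofLp = 0 := by
  simp [kerΘstar, Matrix.toLpLin_apply, Θ_conjTranspose]

lemma pow_TS_mulVec (k : ℕ) (x : Phase L → ℂ) :
    (m.TS ^ k).mulVec x = Complex.I ^ k • (m.RSc ^ k).mulVec x := by
  rw [TS_eq, smul_pow, Matrix.smul_mulVec]

lemma mem_kalmanSpace_orthogonal_of_lt (x : EuclideanSpace ℂ (Phase L)) :
    x ∈ m.kalmanSpaceᗮ ↔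
      ∀ k < 2 * L + 1, m.Θ.conjTranspose.mulVec ((m.TS ^ k).mulVec x.ofLp) = 0 := by
  have h (k : ℕ) : x ∈ (LinearMap.range (Matrix.toEuclideanLin (m.TS ^ k * m.Θ)))ᗮ ↔
      m.Θ.conjTranspose.mulVec ((m.TS ^ k).mulVec x.ofLp) = 0 := by
    rw [LinearMap.orthogonal_range, ← Matrix.toEuclideanLin_conjTranspose_eq_adjoint,
      Matrix.conjTranspose_mul, Matrix.conjTranspose_pow, m.TS_isHermitian.eq]
    rw [LinearMap.mem_ker, Matrix.toLpLin_apply, WithLp.toLp_eq_zero, ← Matrix.mulVec_mulVec]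
  simp only [kalmanSpace, ← h]
  rw [← Submodule.iInf_orthogonal, Submodule.mem_iInf]
  refine forall_congr' fun k => ?_
  by_cases hk : k < 2 * L + 1 <;> simp [hk]

/-- Cayley–Hamilton: reducing X^n modulo the characteristic polynomial leaves only the powers
already controlled. -/
lemma pow_card_RSc_mem (n : ℕ) (x : Phase L → ℂ)
    (hx : ∀ k < 2 * L + 1, m.Θ.conjTranspose.mulVec ((m.TS ^ k).mulVec x) = 0) :
    m.Θ.conjTranspose.mulVec ((m.TS ^ n).mulVec x) = 0 := by
  rw [Matrix.pow_eq_aeval_mod_charpoly m.TS n]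
  set p := (Polynomial.X ^ n %ₘ m.TS.charpoly : Polynomial ℂ) with hp
  rw [Polynomial.aeval_eq_sum_range, Matrix.sum_mulVec, Matrix.mulVec_sum]
  refine Finset.sum_eq_zero fun k hk => ?_
  rw [Matrix.smul_mulVec, Matrix.mulVec_smul, hx k, smul_zero]
  -- The weak bound on the degree of the remainder is enough, since the power 2L is itself among the
  -- hypotheses.
  have h1 : p.natDegree ≤ 2 * L := by
    have := Polynomial.natDegree_modByMonic_le (Polynomial.X ^ n) m.TS.charpoly_monic
    rw [Matrix.charpoly_natDegree_eq_dim] at this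
    simp [Phase] at this
    rw [hp]; omega
  have := Finset.mem_range.mp hk
  omega

lemma mem_kalmanSpace_orthogonal (x : EuclideanSpace ℂ (Phase L)) :
    x ∈ m.kalmanSpaceᗮ ↔
      ∀ k, m.Wc.transpose.mulVec ((m.RSc ^ k).mulVec x.ofLp) = 0 := by
  have h (k : ℕ) : m.Θ.conjTranspose.mulVec ((m.TS ^ k).mulVec x.ofLp) = 0 ↔
      m.Wc.transpose.mulVec ((m.RSc ^ k).mulVec x.ofLp) = 0 := by
    rw [pow_TS_mulVec, Θ_conjTranspose, Matrix.smul_mulVec, Matrix.mulVec_smul]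
    simp
  simp only [mem_kalmanSpace_orthogonal_of_lt, ← h]
  exact ⟨fun hx n => m.pow_card_RSc_mem n _ hx, fun hx k _ => hx k⟩

lemma opTS_mem_kalmanSpace_orthogonal (x : EuclideanSpace ℂ (Phase L)) (hx : x ∈ m.kalmanSpaceᗮ) :
    m.opTS x ∈ m.kalmanSpaceᗮ := by
  rw [mem_kalmanSpace_orthogonal] at hx ⊢
  intro k
  have := hx (k + 1)
  rw [opTS_apply, TS_eq, Matrix.smul_mulVec, Matrix.mulVec_smul, Matrix.mulVec_smul,
    Matrix.mulVec_mulVec (M := m.RSc ^ k), ← pow_succ, this, smul_zero]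

lemma kalmanSpace_orthogonal_le_kerΘstar : m.kalmanSpaceᗮ ≤ m.kerΘstar := fun x hx => by
  rw [mem_kalmanSpace_orthogonal] at hx
  simpa [mem_kerΘstar] using hx 0

/-- On an eigenvector every power of `RSc` is a scalar, so the condition for k = 0 gives all the
others. -/
lemma eigenspace_inf_kerΘstar_le (μ : ℂ) :
    Module.End.eigenspace m.opTS μ ⊓ m.kerΘstar ≤ m.kalmanSpaceᗮ := by
  rintro x ⟨h1, h2⟩
  rw [SetLike.mem_coe, Module.End.mem_eigenspace_iff] at h1
  rw [SetLike.mem_coe, mem_kerΘstar] at h2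
  rw [mem_kalmanSpace_orthogonal]
  have h1' : m.RSc.mulVec x.ofLp = (-Complex.I * μ) • x.ofLp := by
    have := congrArg WithLp.ofLp h1
    rw [opTS_apply, TS_eq, Matrix.smul_mulVec] at this
    have := congrArg ((-Complex.I) • ·) this
    simpa [smul_smul] using this
  have (k : ℕ) : (m.RSc ^ k).mulVec x.ofLp = (-Complex.I * μ) ^ k • x.ofLp := by
    induction k with
    | zero => simp
    | succ k ih =>
      rw [pow_succ, ← Matrix.mulVec_mulVec, h1', Matrix.mulVec_smul, ih, smul_smul, ← pow_succ']
  intro k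
  rw [this, Matrix.mulVec_smul, h2, smul_zero]

lemma opTS_isSymmetric : m.opTS.IsSymmetric :=
  Matrix.isSymmetric_toEuclideanLin_iff.mpr m.TS_isHermitian

/-- `TS` is Hermitian and preserves the complement, which is therefore the sum of its intersections
with the eigenspaces; each of these lies in `kerΘstar`. -/
theorem subsingleton_iff_kalmanSpace_orthogonal_le :
    {μ : ℂ | Module.End.eigenspace m.opTS μ ⊓ m.kerΘstar ≠ ⊥}.Subsingleton ↔
      ∃ μ : ℂ, m.kalmanSpaceᗮ ≤ Module.End.eigenspace m.opTS μ := by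
  constructor
  · intro h
    have htop : ⨆ μ, Module.End.eigenspace m.opTS μ = ⊤ :=
      Submodule.orthogonal_eq_bot_iff.mp
        m.opTS_isSymmetric.orthogonalComplement_iSup_eigenspaces_eq_bot
    have hdec : m.kalmanSpaceᗮ = ⨆ μ, m.kalmanSpaceᗮ ⊓ Module.End.eigenspace m.opTS μ := by
      have := Submodule.inf_iSup_genEigenspace (p := m.kalmanSpaceᗮ) (f := m.opTS)
        m.opTS_mem_kalmanSpace_orthogonal 1
      change _ ⊓ (⨆ μ, Module.End.eigenspace m.opTS μ) = _ at this
      rw [htop, inf_top_eq] at this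
      exact this
    have hle (μ : ℂ) : m.kalmanSpaceᗮ ⊓ Module.End.eigenspace m.opTS μ ≤
        Module.End.eigenspace m.opTS μ ⊓ m.kerΘstar :=
      le_inf inf_le_right (inf_le_left.trans m.kalmanSpace_orthogonal_le_kerΘstar)
    by_cases hex : ∃ μ, Module.End.eigenspace m.opTS μ ⊓ m.kerΘstar ≠ ⊥
    · obtain ⟨μ, hμ⟩ := hex
      refine ⟨μ, hdec.le.trans (iSup_le fun ν => ?_)⟩
      by_cases hν : Module.End.eigenspace m.opTS ν ⊓ m.kerΘstar = ⊥
      · exact ((hle ν).trans hν.le).trans bot_le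
      · rw [h hμ hν]; exact inf_le_right
    · push Not at hex
      -- Here the complement is zero, so any eigenvalue would serve.
      refine ⟨0, hdec.le.trans (iSup_le fun ν => ?_)⟩
      exact ((hle ν).trans (hex ν).le).trans bot_le
  · rintro ⟨μ, hμ⟩
    have key (ν : ℂ) (hν : Module.End.eigenspace m.opTS ν ⊓ m.kerΘstar ≠ ⊥) : ν = μ := by
      obtain ⟨x, hx, hx0⟩ := Submodule.exists_mem_ne_zero_of_ne_bot hν
      have h1 := Module.End.mem_eigenspace_iff.mp (hμ (m.eigenspace_inf_kerΘstar_le ν hx))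
      have h2 := Module.End.mem_eigenspace_iff.mp hx.1
      exact smul_left_injective ℂ hx0 (h2.symm.trans h1)
    exact fun ν hν ν' hν' => (key ν hν).trans (key ν' hν').symm

/-- Both matrices have real entries, so undetectable vectors split into real and imaginary parts. -/
lemma mulVec_star (n : ℕ) (x : Phase L → ℂ) :
    m.Wc.transpose.mulVec ((m.RSc ^ n).mulVec (star x)) =
      star (m.Wc.transpose.mulVec ((m.RSc ^ n).mulVec x)) := by
  have hR : (m.RSc ^ n).map star = m.RSc ^ n := by
    have : (starRingEnd ℂ).mapMatrix m.RSc = m.RSc := by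
      ext i j; simp [RSc]
    change (starRingEnd ℂ).mapMatrix (m.RSc ^ n) = _
    rw [map_pow, this]
  have hW : m.Wc.transpose.map star = m.Wc.transpose := by
    ext i j; simp [Wc]
  rw [Matrix.star_mulVec, Matrix.star_mulVec, ← Matrix.vecMul_transpose, ← Matrix.vecMul_transpose]
  congr 1
  · congr 1
    conv_lhs => rw [← hR]
    rfl
  · conv_lhs => rw [← hW]
    rfl

/-- A real antisymmetric matrix has no nonzero eigenvalue with a real eigenvector. -/
lemma RSc_mulVec_eq_zero_of_star_eq (x : Phase L → ℂ) (hx : star x = x) (μ : ℂ)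
    (h : m.TS.mulVec x = μ • x) : m.TS.mulVec x = 0 := by
  by_cases hx0 : x = 0
  · simp [hx0]
  -- An antisymmetric bilinear form vanishes on the diagonal; since x is real, this reads μ‖x‖² = 0.
  have h0 : x ⬝ᵥ m.TS.mulVec x = 0 := by
    have h1 : x ⬝ᵥ m.TS.mulVec x = -(x ⬝ᵥ m.TS.mulVec x) := by
      conv_lhs => rw [dotProduct_comm, ← Matrix.vecMul_transpose, ← Matrix.dotProduct_mulVec]
      simp [TS_eq, RSc_transpose, Matrix.smul_mulVec, Matrix.neg_mulVec]
    exact self_eq_neg.mp h1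
  rw [h, dotProduct_smul, smul_eq_mul, mul_eq_zero] at h0
  rcases h0 with h0 | h0
  · simp [h, h0]
  · exact absurd (dotProduct_star_self_eq_zero.mp (hx.symm ▸ h0)) hx0

/-- The real and imaginary parts of x are undetectable too, hence eigenvectors for μ, and a real
eigenvector is annihilated. The spectral argument uses the eigenspace condition in this form. -/
theorem RSc_mulVec_eq_zero (h : ∃ μ : ℂ, m.kalmanSpaceᗮ ≤ Module.End.eigenspace m.opTS μ)
    (x : Phase L → ℂ) (hx : ∀ k, m.Wc.transpose.mulVec ((m.RSc ^ k).mulVec x) = 0) :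
    m.RSc.mulVec x = 0 := by
  obtain ⟨μ, hμ⟩ := h
  have hz (y : Phase L → ℂ) (hy : ∀ k, m.Wc.transpose.mulVec ((m.RSc ^ k).mulVec y) = 0)
      (hs : star y = y) : m.TS.mulVec y = 0 := by
    have h1 := hμ ((m.mem_kalmanSpace_orthogonal (WithLp.toLp 2 y)).mpr hy)
    rw [Module.End.mem_eigenspace_iff, opTS_apply] at h1
    exact m.RSc_mulVec_eq_zero_of_star_eq y hs μ (congrArg WithLp.ofLp h1)
  have hs (k : ℕ) : m.Wc.transpose.mulVec ((m.RSc ^ k).mulVec (star x)) = 0 := by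
    rw [mulVec_star, hx, star_zero]
  have h1 := hz (x + star x) (fun k => by simp [Matrix.mulVec_add, hx, hs]) (by simp [add_comm])
  have h2 := hz (Complex.I • (x - star x))
    (fun k => by simp [Matrix.mulVec_sub, Matrix.mulVec_smul, hx, hs]) (by
      simp [smul_sub]; abel)
  have h3 : x = (1 / 2 : ℂ) • ((x + star x) - Complex.I • Complex.I • (x - star x)) := by
    ext i; simp [← mul_assoc]; ring
  have h4 : m.TS.mulVec x = 0 := by
    rw [h3, Matrix.mulVec_smul, Matrix.mulVec_sub, h1, Matrix.mulVec_smul, h2]; simp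
  rw [TS_eq, Matrix.smul_mulVec] at h4
  simpa using h4

end Model

/-! ### Canonical anticommutation relations -/

open scoped symmDiff

variable {n : ℕ}

/-- The operator `|t⟩ ↦ f t • |t ∆ {i}⟩`. -/
noncomputable def weightedFlip (i : Fin n) (f : Finset (Fin n) → ℂ) : Op n :=
  Matrix.of fun s t => if s = t ∆ {i} then f t else 0

lemma weightedFlip_mul (i j : Fin n) (f g : Finset (Fin n) → ℂ) (s t : Finset (Fin n)) :
    (weightedFlip i f * weightedFlip j g) s t =
      if s = t ∆ {j} ∆ {i} then f (t ∆ {j}) * g t else 0 := by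
  simp [weightedFlip, Matrix.mul_apply]

lemma neg_one_pow_card_filter_symmDiff (p : Fin n → Prop) [DecidablePred p]
    (t : Finset (Fin n)) (j : Fin n) :
    (-1 : ℂ) ^ ((t ∆ {j}).filter p).card =
      (if p j then -1 else 1) * (-1) ^ (t.filter p).card := by
  by_cases hj : j ∈ t
  · have h : t ∆ {j} = t.erase j := by
      ext k; simp only [Finset.mem_symmDiff, Finset.mem_singleton, Finset.mem_erase]; grind
    rw [h, Finset.filter_erase]
    split_ifs with hp
    · rw [← Finset.card_erase_add_one (Finset.mem_filter.mpr ⟨hj, hp⟩), pow_succ]; ring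
    · rw [Finset.erase_eq_of_notMem (by simp [hp]), one_mul]
  · have h : t ∆ {j} = insert j t := by
      ext k; simp only [Finset.mem_symmDiff, Finset.mem_singleton, Finset.mem_insert]; grind
    rw [h, Finset.filter_insert]
    split_ifs with hp
    · rw [Finset.card_insert_of_notMem (by simp [hj]), pow_succ]; ring
    · rw [one_mul]

/-- The mode of a Majorana operator. -/
def mode : Phase n → Fin n := Sum.elim id id

/-- The sign `∏_{k<i} (-1)^{t_k}`. -/
noncomputable def jwSign (i : Fin n) (t : Finset (Fin n)) : ℂ :=
  (-1) ^ (t.filter (fun k => k < i)).card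

/-- The local phase of a Majorana operator. -/
noncomputable def localPhase : Phase n → Finset (Fin n) → ℂ
  | Sum.inl _, _ => 1
  | Sum.inr i, t => if i ∈ t then -Complex.I else Complex.I

/-- Both kinds of Majorana operator become one bit flip with a phase, which reduces the
anticommutation relations to sign counting. -/
lemma majorana_eq (p : Phase n) :
    majorana p = weightedFlip (mode p) fun t => localPhase p t * jwSign (mode p) t := by
  have key (i : Fin n) (s t : Finset (Fin n)) :
      (i ∈ t ∧ s = t.erase i ↔ i ∈ t ∧ s = t ∆ {i}) ∧
      (i ∈ s ∧ t = s.erase i ↔ i ∉ t ∧ s = t ∆ {i}) := by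
    constructor
    · refine and_congr_right fun hi => ?_
      have : t ∆ {i} = t.erase i := by
        ext k; simp only [Finset.mem_symmDiff, Finset.mem_singleton, Finset.mem_erase]; grind
      rw [this]
    · constructor
      · rintro ⟨hi, rfl⟩
        refine ⟨by simp, ?_⟩
        ext k; simp only [Finset.mem_symmDiff, Finset.mem_singleton, Finset.mem_erase]; grind
      · rintro ⟨hi, rfl⟩
        refine ⟨by simp [Finset.mem_symmDiff, hi], ?_⟩
        ext k; simp only [Finset.mem_symmDiff, Finset.mem_singleton, Finset.mem_erase]; grind
  have hsgn (i : Fin n) (t : Finset (Fin n)) :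
      (-1 : ℂ) ^ ((t ∆ {i}).filter (fun k => k < i)).card = jwSign i t := by
    rw [neg_one_pow_card_filter_symmDiff]; simp [jwSign]
  ext s t
  rcases p with i | i
  · simp only [majorana, annihilation, Matrix.add_apply, Matrix.conjTranspose_apply, Matrix.of_apply,
      weightedFlip, mode, Sum.elim_inl, id, localPhase, one_mul]
    simp only [(key i s t).1, (key i s t).2]
    by_cases hs : s = t ∆ {i}
    · subst hs
      by_cases hi : i ∈ t <;> simp [hi, hsgn, jwSign]
    · simp [hs]
  · simp only [majorana, annihilation, Matrix.smul_apply, Matrix.sub_apply,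
      Matrix.conjTranspose_apply, Matrix.of_apply,
      weightedFlip, mode, Sum.elim_inr, id, localPhase]
    simp only [(key i s t).1, (key i s t).2]
    by_cases hs : s = t ∆ {i}
    · subst hs
      by_cases hi : i ∈ t <;> simp [hi, hsgn, jwSign]
    · simp [hs]

lemma jwSign_symmDiff (i j : Fin n) (t : Finset (Fin n)) :
    jwSign i (t ∆ {j}) = (if j < i then -1 else 1) * jwSign i t :=
  neg_one_pow_card_filter_symmDiff _ t j

lemma jwSign_mul_self (i : Fin n) (t : Finset (Fin n)) : jwSign i t * jwSign i t = 1 := by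
  rw [jwSign, ← pow_add, Even.neg_one_pow ⟨_, rfl⟩]

lemma localPhase_symmDiff_of_ne (p : Phase n) (j : Fin n) (h : mode p ≠ j)
    (t : Finset (Fin n)) : localPhase p (t ∆ {j}) = localPhase p t := by
  rcases p with i | i
  · rfl
  · simp only [mode, Sum.elim_inr, id] at h
    simp [localPhase, Finset.mem_symmDiff, h]

lemma localPhase_symmDiff_self (p : Phase n) (t : Finset (Fin n)) :
    localPhase p (t ∆ {mode p}) = star (localPhase p t) := by
  rcases p with i | i
  · simp [localPhase]
  · by_cases h : i ∈ t <;> simp [localPhase, Finset.mem_symmDiff, mode, h]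

/-- For distinct modes, flipping the lower one changes the Jordan–Wigner sign of the higher one and
not conversely, so the two orders differ by a sign. In a single mode those signs square to 1 and the
local phases decide. -/
theorem majorana_car (p q : Phase n) :
    majorana p * majorana q + majorana q * majorana p = if p = q then (2 : Op n) else 0 := by
  ext s t
  rw [Matrix.add_apply, majorana_eq, majorana_eq, weightedFlip_mul, weightedFlip_mul]
  by_cases hm : mode p = mode q
  · have h2 (u : Finset (Fin n)) : t ∆ u ∆ u = t := symmDiff_symmDiff_cancel_right u t
    rw [hm, h2]
    simp only [jwSign_symmDiff, lt_irrefl, if_false, one_mul]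
    have hj := jwSign_mul_self (mode q) t
    have hI := Complex.I_mul_I
    by_cases hs : s = t
    · subst hs
      rcases p with i | i <;> rcases q with j | j <;>
        simp only [mode, Sum.elim_inl, Sum.elim_inr, id] at hm <;> subst hm <;>
        simp only [mode, Sum.elim_inl, Sum.elim_inr, id] at hj <;>
        by_cases h : i ∈ s <;>
        simp [localPhase, Finset.mem_symmDiff, mode, h, Matrix.ofNat_apply] <;> grind
    · have : (2 : Op n) s t = 0 := by simp [Matrix.ofNat_apply, hs]
      simp [hs]
      split_ifs <;> simp [this]
  · have hpq : p ≠ q := fun h => hm (h ▸ rfl)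
    rw [if_neg hpq, symmDiff_right_comm t {mode q} {mode p},
      localPhase_symmDiff_of_ne p _ hm, localPhase_symmDiff_of_ne q _ (Ne.symm hm),
      jwSign_symmDiff, jwSign_symmDiff]
    split_ifs with h1 h2 h3 h4
    · exact absurd h2 h3.asymm
    · simp; ring
    · simp; ring
    · exact absurd (le_antisymm (not_lt.mp h2) (not_lt.mp h4)) hm
    · simp

theorem majorana_isHermitian (p : Phase n) : (majorana p).IsHermitian := by
  ext s t
  rw [Matrix.conjTranspose_apply, majorana_eq]
  simp only [weightedFlip, Matrix.of_apply]
  by_cases hs : s = t ∆ {mode p}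
  · subst hs
    have h2 (u : Finset (Fin n)) : t ∆ u ∆ u = t := symmDiff_symmDiff_cancel_right u t
    simp only [h2, if_true]
    rw [localPhase_symmDiff_self, jwSign_symmDiff]
    simp [jwSign]
  · rw [if_neg hs, if_neg, star_zero]
    rintro rfl
    exact hs (symmDiff_symmDiff_cancel_right _ s).symm

lemma parity_isHermitian : (parity n).IsHermitian := by
  simp [parity, Matrix.IsHermitian, Matrix.diagonal_conjTranspose, Pi.star_def]

lemma parity_mul_self : parity n * parity n = 1 := by
  simp [parity, ← mul_pow]

theorem parity_mul_majorana (p : Phase n) : parity n * majorana p = -(majorana p * parity n) := by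
  ext s t
  rw [parity, Matrix.neg_apply, Matrix.diagonal_mul, Matrix.mul_diagonal, majorana_eq]
  simp only [weightedFlip, Matrix.of_apply]
  split_ifs with hs
  · have := neg_one_pow_card_filter_symmDiff (fun _ => True) t (mode p)
    simp only [Finset.filter_true, if_true] at this
    rw [hs, this]; ring
  · simp

/-! ### Imaginary eigenvalues of quadratic operators -/

section Quadratic

open scoped InnerProductSpace

variable {V ι κ : Type*}

/-- The vectors annihilated by all products of `d` operators `D i`. -/
def killed [AddCommGroup V] [Module ℂ V] (D : ι → V →ₗ[ℂ] V) : ℕ → Submodule ℂ V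
  | 0 => ⊥
  | d + 1 => ⨅ i, (killed D d).comap (D i)

lemma mem_killed_succ [AddCommGroup V] [Module ℂ V] {D : ι → V →ₗ[ℂ] V} {d : ℕ} {x : V} :
    x ∈ killed D (d + 1) ↔ ∀ i, D i x ∈ killed D d := by
  simp [killed]

lemma killed_le_succ [AddCommGroup V] [Module ℂ V] (D : ι → V →ₗ[ℂ] V) (d : ℕ) :
    killed D d ≤ killed D (d + 1) := by
  induction d with
  | zero => exact bot_le
  | succ d ih => exact fun x hx => mem_killed_succ.mpr fun i => ih (mem_killed_succ.mp hx i)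

/-- Each D j squares to zero and anticommutes with the others, so applying it removes j from the set
of operators that can still act nontrivially. -/
lemma mem_killed_card [DecidableEq ι] [AddCommGroup V] [Module ℂ V] {D : ι → V →ₗ[ℂ] V}
    (hDD : ∀ i j x, D i (D j x) = -D j (D i x)) (S : Finset ι) (x : V)
    (hx : ∀ i ∉ S, D i x = 0) : x ∈ killed D (S.card + 1) := by
  induction S using Finset.strongInduction generalizing x with
  | H S ih =>
    refine mem_killed_succ.mpr fun j => ?_
    by_cases hj : j ∈ S
    · rw [← Finset.card_erase_add_one hj]
      refine ih _ (Finset.erase_ssubset hj) _ fun i hi => ?_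
      by_cases hij : i = j
      · subst hij
        have h : (2 : ℂ) • D i (D i x) = 0 := by
          rw [two_smul]; exact eq_neg_iff_add_eq_zero.mp (hDD i i x)
        exact (smul_eq_zero.mp h).resolve_left two_ne_zero
      · rw [hDD, hx i (fun h => hi (Finset.mem_erase.mpr ⟨hij, h⟩)), map_zero, neg_zero]
    · rw [hx j hj]; exact zero_mem _

variable [Fintype ι]

/-- The operator `∑ X_{ij} C_i D_j`. -/
def quadOp [AddCommGroup V] [Module ℂ V] (C D : ι → V →ₗ[ℂ] V) (X : Matrix ι ι ℂ) : V →ₗ[ℂ] V :=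
  ∑ i, ∑ j, X i j • (C i ∘ₗ D j)

lemma quadOp_apply [AddCommGroup V] [Module ℂ V] (C D : ι → V →ₗ[ℂ] V) (X : Matrix ι ι ℂ) (x : V) :
    quadOp C D X x = ∑ i, ∑ j, X i j • C i (D j x) := by
  simp [quadOp]

lemma quadOp_lowering_mem_killed [AddCommGroup V] [Module ℂ V] {D : ι → V →ₗ[ℂ] V}
    (Y : Matrix ι ι ℂ) (d : ℕ) (x : V) (hx : x ∈ killed D (d + 1)) :
    quadOp D D Y x ∈ killed D d := by
  rw [quadOp_apply]
  refine sum_mem fun i _ => sum_mem fun j _ => Submodule.smul_mem _ _ ?_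
  cases d with
  | zero =>
    rw [(Submodule.mem_bot ℂ).mp (mem_killed_succ.mp hx j), map_zero]; exact zero_mem _
  | succ d =>
    exact killed_le_succ D d (mem_killed_succ.mp (mem_killed_succ.mp hx j) i)

lemma inner_quadOp_left [NormedAddCommGroup V] [InnerProductSpace ℂ V]
    {C D : ι → V →ₗ[ℂ] V} (hadj : ∀ i x y, ⟪D i x, y⟫_ℂ = ⟪x, C i y⟫_ℂ) (X : Matrix ι ι ℂ) (x y : V) :
    ⟪quadOp C D X x, y⟫_ℂ = ⟪x, quadOp C D X.conjTranspose y⟫_ℂ := by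
  have hadj' (i : ι) (x y : V) : ⟪C i x, y⟫_ℂ = ⟪x, D i y⟫_ℂ := by
    rw [← inner_conj_symm, ← hadj, inner_conj_symm]
  simp only [quadOp_apply, sum_inner, inner_sum, inner_smul_left, inner_smul_right, hadj, hadj',
    Matrix.conjTranspose_apply]
  exact Finset.sum_comm

variable [DecidableEq ι]

lemma killed_eq_top [AddCommGroup V] [Module ℂ V] {D : ι → V →ₗ[ℂ] V}
    (hDD : ∀ i j x, D i (D j x) = -D j (D i x)) : killed D (Fintype.card ι + 1) = ⊤ :=
  eq_top_iff.mpr fun x _ => mem_killed_card hDD Finset.univ x (by simp)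

/-- The commutator of D p with the quadratic operator is again linear in the D j: the two signs
cancel and only the contraction of D p with C p survives. -/
lemma apply_quadOp [AddCommGroup V] [Module ℂ V] {C D : ι → V →ₗ[ℂ] V}
    (hDD : ∀ i j x, D i (D j x) = -D j (D i x))
    (hDC : ∀ i j x, D i (C j x) + C j (D i x) = if i = j then x else 0)
    (X : Matrix ι ι ℂ) (p : ι) (x : V) :
    D p (quadOp C D X x) = ∑ j, X p j • D j x + quadOp C D X (D p x) := by
  have h (i j : ι) : D p (C i (D j x)) = (if p = i then D j x else 0) + C i (D j (D p x)) := by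
    rw [← hDC p i (D j x), hDD p j x, map_neg]; abel
  simp only [quadOp_apply, map_sum, map_smul, h, smul_add, Finset.sum_add_distrib]
  congr 1
  rw [Finset.sum_eq_single p]
  · simp
  · intro i _ hi; simp [Ne.symm hi]
  · simp

/-- As this holds for every X, it applies to the adjoint too, so orthogonal complements of the
filtration are also preserved. -/
lemma quadOp_mem_killed [AddCommGroup V] [Module ℂ V] {C D : ι → V →ₗ[ℂ] V}
    (hDD : ∀ i j x, D i (D j x) = -D j (D i x))
    (hDC : ∀ i j x, D i (C j x) + C j (D i x) = if i = j then x else 0)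
    (X : Matrix ι ι ℂ) (d : ℕ) (x : V) (hx : x ∈ killed D d) :
    quadOp C D X x ∈ killed D d := by
  induction d generalizing x with
  | zero => rw [(Submodule.mem_bot ℂ).mp hx, map_zero]; exact zero_mem _
  | succ d ih =>
    refine mem_killed_succ.mpr fun p => ?_
    rw [apply_quadOp hDD hDC]
    rw [mem_killed_succ] at hx
    exact add_mem (sum_mem fun j _ => Submodule.smul_mem _ _ (hx j)) (ih _ (hx p))

variable [Fintype κ] [NormedAddCommGroup V] [InnerProductSpace ℂ V] {C D : ι → V →ₗ[ℂ] V}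

omit [DecidableEq ι] in
/-- A dissipative `quadOp` eigenvector with imaginary eigenvalue is not damped. -/
lemma sum_smul_eq_zero_of_re_eq_zero (hadj : ∀ i x y, ⟪D i x, y⟫_ℂ = ⟪x, C i y⟫_ℂ)
    {R : Matrix ι ι ℂ} {W : Matrix ι κ ℂ} (hR : R.conjTranspose = -R)
    (hW : W.conjTranspose = W.transpose) {x : V} {c : ℂ} (hc : c.re = 0)
    (hx : quadOp C D (-(2 : ℂ) • R - (2 : ℂ) • (W * W.transpose)) x = c • x) (k : κ) :
    ∑ j, W j k • D j x = 0 := by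
  have hadj' (i : ι) (x y : V) : ⟪x, C i y⟫_ℂ = ⟪D i x, y⟫_ℂ := (hadj i x y).symm
  have hWc (i : ι) (k : κ) : (starRingEnd ℂ) (W i k) = W i k := by
    have := congrFun (congrFun hW k) i
    simpa using this
  set z := ∑ i, ∑ j, R i j * ⟪D i x, D j x⟫_ℂ with hz
  -- R is anti-Hermitian, so its quadratic form is imaginary and only the damping from W remains in
  -- the real part.
  have hz0 : z.re = 0 := by
    have h1 : (starRingEnd ℂ) z = -z := by
      simp only [hz, map_sum, map_mul, inner_conj_symm]
      rw [Finset.sum_comm, ← Finset.sum_neg_distrib]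
      refine Finset.sum_congr rfl fun i _ => ?_
      rw [← Finset.sum_neg_distrib]
      refine Finset.sum_congr rfl fun j _ => ?_
      have := congrFun (congrFun hR i) j
      simp only [Matrix.conjTranspose_apply, Matrix.neg_apply] at this
      rw [starRingEnd_apply, this, neg_mul]
    have := congrArg Complex.re h1
    simp only [Complex.conj_re, Complex.neg_re] at this
    linarith
  have h1 : ⟪x, quadOp C D (-(2 : ℂ) • R - (2 : ℂ) • (W * W.transpose)) x⟫_ℂ =
      -2 * z - 2 * ∑ k, ⟪∑ j, W j k • D j x, ∑ j, W j k • D j x⟫_ℂ := by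
    have h2 : ∑ k, ⟪∑ j, W j k • D j x, ∑ j, W j k • D j x⟫_ℂ =
        ∑ i, ∑ j, (W * W.transpose) i j * ⟪D i x, D j x⟫_ℂ := by
      simp only [sum_inner, inner_sum, inner_smul_left, inner_smul_right, hWc, Matrix.mul_apply,
        Matrix.transpose_apply, Finset.sum_mul, Finset.mul_sum]
      refine Finset.sum_comm.trans (Eq.trans ?_ Finset.sum_comm)
      refine Finset.sum_congr rfl fun i _ => Finset.sum_comm.trans ?_
      exact Finset.sum_congr rfl fun j _ => Finset.sum_congr rfl fun k _ => by ring
    rw [h2, hz, Finset.mul_sum, Finset.mul_sum, ← Finset.sum_sub_distrib]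
    simp only [quadOp_apply, inner_sum, inner_smul_right, hadj']
    refine Finset.sum_congr rfl fun i _ => ?_
    rw [Finset.mul_sum, Finset.mul_sum, ← Finset.sum_sub_distrib]
    refine Finset.sum_congr rfl fun j _ => ?_
    simp only [Matrix.sub_apply, Matrix.smul_apply, smul_eq_mul]
    ring
  have h3 : ∑ k, ‖∑ j, W j k • D j x‖ ^ 2 = 0 := by
    have hre (v : V) : (⟪v, v⟫_ℂ).re = ‖v‖ ^ 2 := inner_self_eq_norm_sq (𝕜 := ℂ) v
    have him (v : V) : (⟪v, v⟫_ℂ).im = 0 := inner_self_im (𝕜 := ℂ) v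
    rw [hx, inner_smul_right] at h1
    have h4 := congrArg Complex.re h1
    simp only [Complex.mul_re, Complex.sub_re, Complex.re_sum, him, hre, hc, hz0, Complex.neg_re,
      Complex.re_ofNat, Complex.im_ofNat, Complex.neg_im] at h4
    linarith
  have h5 := (Finset.sum_eq_zero_iff_of_nonneg fun k _ => sq_nonneg _).mp h3 k (Finset.mem_univ k)
  simpa using h5

/-- Imaginary eigenvalues of `∑ X_{ij} C_i D_j + ∑ Y_{ij} D_i D_j` vanish, for
`X = -2 R - 2 W Wᵀ`, if `R` vanishes on the vectors undetectable by `Wᵀ`. -/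
theorem eigenvalue_eq_zero_of_re_eq_zero [FiniteDimensional ℂ V]
    (hadj : ∀ i x y, ⟪D i x, y⟫_ℂ = ⟪x, C i y⟫_ℂ)
    (hDD : ∀ i j x, D i (D j x) = -D j (D i x))
    (hDC : ∀ i j x, D i (C j x) + C j (D i x) = if i = j then x else 0)
    {R : Matrix ι ι ℂ} {W : Matrix ι κ ℂ} (hR : R.conjTranspose = -R)
    (hW : W.conjTranspose = W.transpose)
    (hker : ∀ x : ι → ℂ, (∀ n, W.transpose.mulVec ((R ^ n).mulVec x) = 0) → R.mulVec x = 0)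
    (Y : Matrix ι ι ℂ) {c : ℂ} (hc : c.re = 0) {x : V} (hx0 : x ≠ 0)
    (hx : quadOp C D (-(2 : ℂ) • R - (2 : ℂ) • (W * W.transpose)) x + quadOp D D Y x = c • x) :
    c = 0 := by
  classical
  set X := -(2 : ℂ) • R - (2 : ℂ) • (W * W.transpose) with hX
  have hex : ∃ d, x ∈ killed D d := ⟨_, (killed_eq_top hDD).symm ▸ Submodule.mem_top⟩
  obtain ⟨d, hd1, hd2⟩ : ∃ d, x ∈ killed D (d + 1) ∧ x ∉ killed D d := by
    have h0 : Nat.find hex ≠ 0 := fun h => hx0 (by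
      have := Nat.find_spec hex
      rw [h] at this
      exact (Submodule.mem_bot ℂ).mp this)
    obtain ⟨d, hd⟩ := Nat.exists_eq_succ_of_ne_zero h0
    refine ⟨d, ?_, Nat.find_min hex (by omega)⟩
    have := Nat.find_spec hex
    rwa [hd] at this
  -- z is the part of x of top degree. The Y term sends x into `killed D d`, so modulo that subspace
  -- the equation for x becomes one for z alone.
  obtain ⟨y, hy, z, hz, rfl⟩ := (killed D d).exists_add_mem_mem_orthogonal x
  have hz0 : z ≠ 0 := fun h => hd2 (by simpa [h] using hy)
  have hzK : quadOp C D X z = c • z := by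
    have h1 : quadOp C D X z - c • z ∈ killed D d := by
      have : quadOp C D X z - c • z = c • y - quadOp C D X y - quadOp D D Y (y + z) := by
        rw [map_add (quadOp C D X), smul_add] at hx
        rw [sub_sub, sub_eq_sub_iff_add_eq_add, ← hx]
        abel
      rw [this]
      exact sub_mem (sub_mem (Submodule.smul_mem _ _ hy) (quadOp_mem_killed hDD hDC X d y hy))
        (quadOp_lowering_mem_killed Y d _ hd1)
    have h2 : quadOp C D X z - c • z ∈ (killed D d)ᗮ := by
      refine sub_mem ?_ (Submodule.smul_mem _ _ hz)
      rw [Submodule.mem_orthogonal']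
      intro u hu
      rw [inner_quadOp_left hadj]
      exact (Submodule.mem_orthogonal' _ _).mp hz _ (quadOp_mem_killed hDD hDC _ d u hu)
    exact sub_eq_zero.mp ((Submodule.mem_bot ℂ).mp
      ((killed D d).inf_orthogonal_eq_bot ▸ ⟨h1, h2⟩))
  have hWz := sum_smul_eq_zero_of_re_eq_zero hadj hR hW hc hzK
  have hK : quadOp C D (-(2 : ℂ) • R) z = c • z := by
    rw [← hzK, hX]
    have h3 : quadOp C D (W * W.transpose) z = 0 := by
      rw [quadOp_apply]
      refine Finset.sum_eq_zero fun i _ => ?_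
      have : ∑ j, (W * W.transpose) i j • C i (D j z) =
          C i (∑ k, W i k • ∑ j, W j k • D j z) := by
        simp only [Matrix.mul_apply, Matrix.transpose_apply, map_sum, map_smul, Finset.sum_smul,
          Finset.smul_sum, smul_smul]
        exact Finset.sum_comm
      rw [this]
      simp [hWz]
    rw [quadOp_apply] at h3 ⊢
    rw [quadOp_apply]
    simp only [Matrix.sub_apply, sub_smul, Finset.sum_sub_distrib, Matrix.smul_apply (2 : ℂ),
      smul_eq_mul, mul_smul, ← Finset.smul_sum, h3, smul_zero, sub_zero]
  -- Applying D p to the eigenvalue equation shows that the linear relations among the D p z are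
  -- stable under right multiplication by R.
  have hstep (u : ι → ℂ) (hu : ∑ p, u p • D p z = 0) :
      ∑ p, (R.vecMul u) p • D p z = 0 := by
    have h1 (p : ι) : c • D p z =
        -(2 : ℂ) • ∑ j, R p j • D j z + quadOp C D (-(2 : ℂ) • R) (D p z) := by
      rw [← map_smul, ← hK, apply_quadOp hDD hDC, Finset.smul_sum]
      simp [smul_smul]
    have h2 : ∑ p, u p • c • D p z = -(2 : ℂ) • ∑ p, u p • ∑ j, R p j • D j z := by
      have hq : ∑ p, u p • quadOp C D (-(2 : ℂ) • R) (D p z) = 0 := by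
        have := map_sum (quadOp C D (-(2 : ℂ) • R)) (fun p => u p • D p z) Finset.univ
        simp only [hu, map_zero, map_smul] at this
        exact this.symm
      simp only [h1, smul_add, Finset.sum_add_distrib, hq, add_zero, smul_comm _ (-2 : ℂ),
        ← Finset.smul_sum]
    simp only [smul_comm _ c, ← Finset.smul_sum, hu, smul_zero] at h2
    have h3 : ∑ p, u p • ∑ j, R p j • D j z = 0 := by
      simpa using h2.symm
    rw [← h3]
    simp only [Finset.smul_sum, Matrix.vecMul, dotProduct, Finset.sum_smul, smul_smul]
    exact Finset.sum_comm
  have hall (n : ℕ) (k : κ) : ∑ p, (W.transpose * R ^ n) k p • D p z = 0 := by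
    induction n with
    | zero => simpa using hWz k
    | succ n ih =>
      have := hstep _ ih
      rwa [pow_succ, ← Matrix.mul_assoc]
  have hRz (i : ι) : ∑ j, R i j • D j z = 0 := by
    -- Pairing with a fixed e turns the vector relations into the scalar ones that `hker` accepts.
    refine ext_inner_left ℂ fun e => ?_
    have := hker (fun j => ⟪e, D j z⟫_ℂ) (fun n => by
      ext k
      have := congrArg (fun v => ⟪e, v⟫_ℂ) (hall n k)
      simp only [inner_sum, inner_smul_right, inner_zero_right] at this
      rw [Matrix.mulVec_mulVec]
      exact this)
    have := congrFun this i
    simp only [inner_sum, inner_smul_right, inner_zero_right]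
    exact this
  have hfin : quadOp C D (-(2 : ℂ) • R) z = 0 := by
    rw [quadOp_apply]
    refine Finset.sum_eq_zero fun i _ => ?_
    have := congrArg (fun v => (-2 : ℂ) • C i v) (hRz i)
    simpa [Finset.smul_sum, smul_smul] using this
  rw [hfin] at hK
  exact (smul_eq_zero.mp hK.symm).resolve_right hz0

end Quadratic

/-! ### Semigroups of operators -/

section Chernoff

open Filter Asymptotics

lemma norm_pow_sub_pow_le {𝔸 : Type*} [NormedRing 𝔸] [NormOneClass 𝔸] {A B : 𝔸} {r : ℝ}
    (hr : 1 ≤ r) (hA : ‖A‖ ≤ r) (hB : ‖B‖ ≤ r) (n : ℕ) :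
    ‖A ^ n - B ^ n‖ ≤ n * r ^ n * ‖A - B‖ := by
  have hr0 : 0 ≤ r := zero_le_one.trans hr
  induction n with
  | zero => simp
  | succ n ih =>
    have h1 : A ^ (n + 1) - B ^ (n + 1) = A * (A ^ n - B ^ n) + (A - B) * B ^ n := by
      rw [pow_succ', pow_succ']; noncomm_ring
    rw [h1]
    calc ‖A * (A ^ n - B ^ n) + (A - B) * B ^ n‖
        ≤ ‖A‖ * ‖A ^ n - B ^ n‖ + ‖A - B‖ * ‖B ^ n‖ :=
          (norm_add_le _ _).trans (add_le_add (norm_mul_le _ _) (norm_mul_le _ _))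
      _ ≤ r * (n * r ^ n * ‖A - B‖) + ‖A - B‖ * r ^ (n + 1) := by
          gcongr
          calc ‖B ^ n‖ ≤ ‖B‖ ^ n := norm_pow_le B n
            _ ≤ r ^ n := by gcongr
            _ ≤ r ^ (n + 1) := pow_le_pow_right₀ hr (Nat.le_succ n)
      _ = ((n + 1 : ℕ) : ℝ) * r ^ (n + 1) * ‖A - B‖ := by push_cast; ring

variable {𝔸 : Type*} [NormedRing 𝔸] [NormedAlgebra ℂ 𝔸] [NormOneClass 𝔸]

/-- The 1 added to ‖M‖ absorbs the o(τ) remainder. -/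
lemma eventually_norm_le_exp {F : ℝ → 𝔸} {M : 𝔸}
    (hF : (fun τ : ℝ => F τ - 1 - (τ : ℂ) • M) =o[𝓝[>] 0] fun τ : ℝ => τ) :
    ∀ᶠ τ in 𝓝[>] (0 : ℝ), ‖F τ‖ ≤ Real.exp (τ * (1 + ‖M‖)) := by
  filter_upwards [hF.bound zero_lt_one, self_mem_nhdsWithin] with τ h1 h2
  have h2' : 0 < τ := h2
  have h3 : F τ = 1 + (τ : ℂ) • M + (F τ - 1 - (τ : ℂ) • M) := by abel
  have h4 : ‖(τ : ℂ) • M‖ = τ * ‖M‖ := by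
    rw [norm_smul, Complex.norm_real, Real.norm_of_nonneg h2'.le]
  rw [Real.norm_of_nonneg h2'.le, one_mul] at h1
  calc ‖F τ‖ ≤ ‖(1 : 𝔸)‖ + ‖(τ : ℂ) • M‖ + ‖F τ - 1 - (τ : ℂ) • M‖ := by
        conv_lhs => rw [h3]
        exact norm_add₃_le
    _ ≤ 1 + τ * ‖M‖ + τ := by rw [norm_one, h4]; gcongr
    _ = τ * (1 + ‖M‖) + 1 := by ring
    _ ≤ _ := Real.add_one_le_exp _

/-- F and τ ↦ exp(τM) differ by o(τ). Telescoping over at most t/τ factors, whose products stay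
bounded by exp(t(1 + ‖M‖)), keeps the difference of the powers o(1). -/
theorem tendsto_pow_floor_exp [CompleteSpace 𝔸] {F : ℝ → 𝔸} {M : 𝔸}
    (hF : (fun τ : ℝ => F τ - 1 - (τ : ℂ) • M) =o[𝓝[>] 0] fun τ : ℝ => τ) {t : ℝ} (ht : 0 ≤ t) :
    Tendsto (fun τ : ℝ => F τ ^ ⌊t / τ⌋₊) (𝓝[>] 0) (𝓝 (NormedSpace.exp ((t : ℂ) • M))) := by
  have : NormedAlgebra ℚ 𝔸 := NormedAlgebra.restrictScalars ℚ ℂ 𝔸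
  set E : ℝ → 𝔸 := fun τ => NormedSpace.exp ((τ : ℂ) • M) with hE
  have hEo : (fun τ : ℝ => E τ - 1 - (τ : ℂ) • M) =o[𝓝[>] 0] fun τ : ℝ => τ := by
    have h1 := hasDerivAt_exp_smul_const (𝕂 := ℝ) M 0
    rw [hasDerivAt_iff_isLittleO] at h1
    simpa [hE, Complex.coe_smul] using h1.mono nhdsWithin_le_nhds
  have hfl : Tendsto (fun τ : ℝ => (⌊t / τ⌋₊ : ℝ) * τ) (𝓝[>] 0) (𝓝 t) := by
    have h1 := (tendsto_nat_floor_mul_div_atTop (R := ℝ) ht).comp tendsto_inv_nhdsGT_zero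
    refine h1.congr fun τ => ?_
    simp [div_eq_mul_inv]
  have hElim : Tendsto (fun τ : ℝ => E τ ^ ⌊t / τ⌋₊) (𝓝[>] 0) (𝓝 (E t)) := by
    have h1 : Continuous E := NormedSpace.exp_continuous.comp (by fun_prop)
    refine ((h1.tendsto t).comp hfl).congr fun τ => ?_
    simp only [Function.comp, hE]
    rw [← NormedSpace.exp_nsmul, ← Nat.cast_smul_eq_nsmul ℂ, smul_smul]
    push_cast
    rfl
  have hdiff : Tendsto (fun τ : ℝ => F τ ^ ⌊t / τ⌋₊ - E τ ^ ⌊t / τ⌋₊) (𝓝[>] 0) (𝓝 0) := by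
    have ho : (fun τ : ℝ => F τ - E τ) =o[𝓝[>] 0] fun τ : ℝ => τ := by
      refine (hF.sub hEo).congr_left fun τ => by abel
    have hb : ∀ᶠ τ in 𝓝[>] (0 : ℝ), ‖F τ ^ ⌊t / τ⌋₊ - E τ ^ ⌊t / τ⌋₊‖ ≤
        (t * Real.exp (t * (1 + ‖M‖))) * ‖τ⁻¹ • (F τ - E τ)‖ := by
      filter_upwards [eventually_norm_le_exp hF, eventually_norm_le_exp hEo,
        self_mem_nhdsWithin] with τ h1 h2 h3
      have h3' : 0 < τ := h3
      have h4 : (⌊t / τ⌋₊ : ℝ) ≤ t / τ := Nat.floor_le (by positivity)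
      have h5 : (⌊t / τ⌋₊ : ℝ) * τ ≤ t := (le_div_iff₀ h3').mp h4
      refine (norm_pow_sub_pow_le (Real.one_le_exp (by positivity)) h1 h2 _).trans ?_
      have h6 : (⌊t / τ⌋₊ : ℝ) * Real.exp (τ * (1 + ‖M‖)) ^ ⌊t / τ⌋₊ ≤
          t * Real.exp (t * (1 + ‖M‖)) * τ⁻¹ := by
        rw [← Real.exp_nat_mul, ← mul_assoc]
        calc (⌊t / τ⌋₊ : ℝ) * Real.exp (⌊t / τ⌋₊ * τ * (1 + ‖M‖))
            ≤ t / τ * Real.exp (t * (1 + ‖M‖)) := by gcongr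
          _ = t * Real.exp (t * (1 + ‖M‖)) * τ⁻¹ := by ring
      rw [norm_smul, norm_inv, Real.norm_of_nonneg h3'.le, ← mul_assoc]
      exact mul_le_mul_of_nonneg_right h6 (norm_nonneg _)
    refine squeeze_zero_norm' hb ?_
    have h1 : Tendsto (fun τ : ℝ => τ⁻¹ • (F τ - E τ)) (𝓝[>] 0) (𝓝 0) :=
      ho.tendsto_inv_smul_nhds_zero
    simpa using (h1.norm.const_mul (t * Real.exp (t * (1 + ‖M‖))))
  have h := hdiff.add hElim
  simp only [sub_add_cancel, zero_add] at h
  exact h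

end Chernoff

/-! ### Convergence of bounded one-parameter semigroups in finite dimension -/

section Convergence

open Filter

variable {V : Type*} [NormedAddCommGroup V] [NormedSpace ℂ V] [CompleteSpace V]

lemma hasSum_exp_smul_apply (N : V →L[ℂ] V) (t : ℝ) (v : V) :
    HasSum (fun n : ℕ => ((n.factorial : ℂ)⁻¹ * (t : ℂ) ^ n) • (N ^ n) v)
      (NormedSpace.exp ((t : ℂ) • N) v) := by
  have h := (NormedSpace.exp_series_hasSum_exp' (𝕂 := ℂ) ((t : ℂ) • N)).mapL
    (ContinuousLinearMap.apply ℂ V v)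
  simp only [smul_pow, smul_smul] at h
  exact h

lemma exp_smul_eq_exp_smul_exp (M : V →L[ℂ] V) (c : ℂ) (t : ℝ) :
    NormedSpace.exp ((t : ℂ) • M) =
      Complex.exp (t * c) • NormedSpace.exp ((t : ℂ) • (M - c • 1)) := by
  have : NormedAlgebra ℚ (V →L[ℂ] V) := NormedAlgebra.restrictScalars ℚ ℂ _
  have h1 : (t : ℂ) • M = algebraMap ℂ (V →L[ℂ] V) (t * c) + (t : ℂ) • (M - c • 1) := by
    rw [Algebra.algebraMap_eq_smul_one, smul_sub, smul_smul]; abel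
  rw [h1, NormedSpace.exp_add_of_commute (Algebra.commute_algebraMap_left _ _),
    ← NormedSpace.algebraMap_exp_comm, ← Complex.exp_eq_exp_ℂ, Algebra.algebraMap_eq_smul_one,
    smul_mul_assoc, one_mul]

lemma exp_smul_apply_of_pow_apply_eq_zero (M : V →L[ℂ] V) (c : ℂ) (t : ℝ) (k : ℕ) (v : V)
    (hv : ((M - c • 1) ^ k) v = 0) :
    NormedSpace.exp ((t : ℂ) • M) v = Complex.exp (t * c) •
      ∑ n ∈ Finset.range k, ((n.factorial : ℂ)⁻¹ * (t : ℂ) ^ n) • ((M - c • 1) ^ n) v := by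
  rw [exp_smul_eq_exp_smul_exp M c, _root_.smul_apply]
  congr 1
  refine (hasSum_exp_smul_apply _ t v).unique (hasSum_sum_of_ne_finset_zero fun n hn => ?_)
  obtain ⟨j, rfl⟩ := Nat.exists_eq_add_of_le (not_lt.mp (fun h => hn (Finset.mem_range.mpr h)))
  rw [add_comm k j, pow_add (M - c • 1), mul_apply_eq_comp, hv, map_zero, smul_zero]

/-- A left eigenfunctional evolves by a phase. -/
lemma apply_exp_smul_of_eigen (M : V →L[ℂ] V) (f : V →L[ℂ] ℂ) (c : ℂ)
    (hf : ∀ v, f (M v) = c * f v) (t : ℝ) (v : V) :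
    f (NormedSpace.exp ((t : ℂ) • M) v) = Complex.exp (t * c) * f v := by
  rw [exp_smul_eq_exp_smul_exp M c, _root_.smul_apply, map_smul, smul_eq_mul]
  congr 1
  refine ((hasSum_exp_smul_apply (M - c • 1) t v).mapL f).unique ?_
  have h := hasSum_single (f := fun n : ℕ =>
    f (((n.factorial : ℂ)⁻¹ * (t : ℂ) ^ n) • ((M - c • 1) ^ n) v)) 0 (fun n hn => by
      obtain ⟨j, rfl⟩ := Nat.exists_eq_succ_of_ne_zero hn
      rw [map_smul, Nat.succ_eq_add_one, pow_succ' (M - c • 1), mul_apply_eq_comp]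
      simp [hf])
  simpa using h

/-- On a generalized eigenspace the orbit is e^{tc} times a polynomial. It decays if Re c < 0;
otherwise boundedness excludes Jordan blocks and Re c > 0, and the spectral hypothesis leaves c = 0.
-/
theorem tendsto_exp_of_bounded [FiniteDimensional ℂ V] (M : V →L[ℂ] V)
    (hb : ∀ v, ∃ B, ∀ t : ℝ, 0 ≤ t → ‖NormedSpace.exp ((t : ℂ) • M) v‖ ≤ B)
    (hev : ∀ (c : ℂ) (v : V), v ≠ 0 → M v = c • v → c.re = 0 → c = 0) (v : V) :
    ∃ w, Tendsto (fun t : ℝ => NormedSpace.exp ((t : ℂ) • M) v) atTop (𝓝 w) := by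
  let S : Submodule ℂ V :=
    { carrier := {v | ∃ w, Tendsto (fun t : ℝ => NormedSpace.exp ((t : ℂ) • M) v) atTop (𝓝 w)}
      add_mem' := by
        rintro a b ⟨w, hw⟩ ⟨w', hw'⟩
        exact ⟨w + w', by simpa using hw.add hw'⟩
      zero_mem' := ⟨0, by simp⟩
      smul_mem' := by
        rintro c a ⟨w, hw⟩
        exact ⟨c • w, by simpa using hw.const_smul c⟩ }
  suffices h : ⨆ c, Module.End.maxGenEigenspace (M : V →ₗ[ℂ] V) c ≤ S by
    rw [Module.End.iSup_maxGenEigenspace_eq_top] at h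
    exact h Submodule.mem_top
  refine iSup_le fun c v hv => ?_
  obtain ⟨k, hk⟩ := (Module.End.mem_maxGenEigenspace _ _ _).mp hv
  have hpow (n : ℕ) (u : V) :
      (((M : V →ₗ[ℂ] V) - c • (1 : Module.End ℂ V)) ^ n) u = ((M - c • 1) ^ n) u := by
    induction n generalizing u with
    | zero => rfl
    | succ n ih =>
      rw [pow_succ, pow_succ, Module.End.mul_apply, mul_apply_eq_comp, ih]
      rfl
  rw [hpow] at hk
  have hnorm (t : ℝ) : ‖Complex.exp (t * c)‖ = Real.exp (t * c.re) := by
    rw [Complex.norm_exp]; simp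
  rcases lt_or_ge c.re 0 with hc | hc
  · refine ⟨0, ?_⟩
    simp only [exp_smul_apply_of_pow_apply_eq_zero M c _ k v hk, Finset.smul_sum, smul_smul]
    rw [← Finset.sum_const_zero (s := Finset.range k)]
    refine tendsto_finsetSum _ fun n _ => ?_
    rw [← zero_smul ℂ (((M - c • 1) ^ n) v)]
    refine Tendsto.smul_const ?_ _
    rw [tendsto_zero_iff_norm_tendsto_zero]
    -- The limit is taken in the variable -t Re c; the constant factor undoes the rescaling of the
    -- power.
    have h1 := ((Real.tendsto_pow_mul_exp_neg_atTop_nhds_zero n).comp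
      (tendsto_id.const_mul_atTop (neg_pos.mpr hc))).const_mul
        ((n.factorial : ℝ)⁻¹ * ((-c.re) ^ n)⁻¹)
    rw [mul_zero] at h1
    refine h1.congr' ?_
    filter_upwards [eventually_ge_atTop 0] with t ht
    simp only [Function.comp, id, norm_mul, hnorm, norm_pow, norm_inv, Complex.norm_real,
      Complex.norm_natCast, Real.norm_of_nonneg ht]
    have : (-c.re) ^ n ≠ 0 := pow_ne_zero _ (neg_ne_zero.mpr hc.ne)
    rw [mul_pow]
    field_simp
  · have hker (w : V) (hw : ((M - c • 1 : V →L[ℂ] V) ^ 2) w = 0) : (M - c • 1) w = 0 := by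
      obtain ⟨B, hB⟩ := hb w
      by_contra hne
      have hpos : 0 < ‖(M - c • 1) w‖ := norm_pos_iff.mpr hne
      -- At this time the linear term of the orbit has norm B + ‖w‖ + 1, which exceeds the bound B
      -- even after w is subtracted.
      set t : ℝ := (B + ‖w‖ + 1) / ‖(M - c • 1) w‖ with ht
      have hB0 : 0 ≤ B := (norm_nonneg _).trans (hB 0 le_rfl)
      have ht0 : 0 ≤ t := by positivity
      have h1 := hB t ht0
      rw [exp_smul_apply_of_pow_apply_eq_zero M c t 2 w hw, norm_smul, hnorm] at h1
      simp only [Finset.sum_range_succ, Finset.sum_range_zero, Nat.factorial, pow_zero, pow_one,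
        Nat.cast_one, inv_one, one_mul, one_smul, zero_add, mul_one,
        one_apply_eq_self] at h1
      have h2 : 1 ≤ Real.exp (t * c.re) := Real.one_le_exp (by positivity)
      have h3 : ‖(t : ℂ) • (M - c • 1) w‖ - ‖w‖ ≤ ‖w + (t : ℂ) • (M - c • 1) w‖ := by
        rw [add_comm]; exact norm_sub_le_norm_add _ _
      have h4 : ‖(t : ℂ) • (M - c • 1) w‖ = B + ‖w‖ + 1 := by
        rw [norm_smul, Complex.norm_real, Real.norm_of_nonneg ht0, ht]
        field_simp
      have h5 := le_mul_of_one_le_left (norm_nonneg (w + (t : ℂ) • (M - c • 1) w)) h2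
      linarith
    have hMv : (M - c • 1) v = 0 := by
      clear hv
      induction k with
      | zero =>
        have : v = 0 := by simpa using hk
        simp [this]
      | succ k ih =>
        rcases k with _ | k
        · simpa using hk
        · refine ih ?_
          rw [pow_succ', mul_apply_eq_comp]
          refine hker _ ?_
          rw [← mul_apply_eq_comp, ← pow_add, add_comm]
          exact hk
    have hMv' : M v = c • v := by
      simpa [sub_eq_zero] using hMv
    have hexp (t : ℝ) : NormedSpace.exp ((t : ℂ) • M) v = Complex.exp (t * c) • v := by
      rw [exp_smul_apply_of_pow_apply_eq_zero M c t 1 v (by simpa using hMv)]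
      simp
    by_cases hv0 : v = 0
    · exact hv0 ▸ S.zero_mem
    by_cases hc0 : c = 0
    · refine ⟨v, ?_⟩
      simp only [hexp, hc0, mul_zero, Complex.exp_zero, one_smul]
      exact tendsto_const_nhds
    · exfalso
      have hcpos : 0 < c.re := hc.lt_of_ne fun h => hc0 (hev c v hv0 hMv' h.symm)
      obtain ⟨B, hB⟩ := hb v
      have h1 : Tendsto (fun t : ℝ => Real.exp (t * c.re) * ‖v‖) atTop atTop :=
        (Real.tendsto_exp_atTop.comp (tendsto_id.atTop_mul_const hcpos)).atTop_mul_const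
          (norm_pos_iff.mpr hv0)
      obtain ⟨t, ht, ht0⟩ :=
        ((h1.eventually_gt_atTop B).and (eventually_ge_atTop 0)).exists
      have := hB t ht0
      rw [hexp, norm_smul, hnorm] at this
      linarith

end Convergence

/-! ### Splitting of the Hamiltonian -/

/-- Majorana operators of the system for which, under either identification, the interaction
couples `αᵢ (-1)^N` to the bath. -/
noncomputable def systemField {L : ℕ} (E : Identification) (i : Phase L) : Op L :=
  match E with
  | Identification.SB => majorana i
  | Identification.BS => Complex.I • (majorana i * parity L)

/-- The Majorana operators of the bath to which the system is coupled. -/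
noncomputable def bathField {K : ℕ} (E : Identification) (j : Phase K) : Op K :=
  match E with
  | Identification.SB => majorana j
  | Identification.BS => (-Complex.I) • (parity K * majorana j)

section Fields

variable {n : ℕ} (E : Identification)

lemma majorana_mul_parity (p : Phase n) : majorana p * parity n = -(parity n * majorana p) := by
  rw [parity_mul_majorana, neg_neg]

lemma majorana_parity_mul_majorana_parity (i j : Phase n) :
    majorana i * parity n * (majorana j * parity n) = -(majorana i * majorana j) := by
  rw [majorana_mul_parity j, mul_neg, mul_assoc, ← mul_assoc (parity n) (parity n),
    parity_mul_self, one_mul]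

lemma parity_majorana_mul_parity_majorana (i j : Phase n) :
    parity n * majorana i * (parity n * majorana j) = -(majorana i * majorana j) := by
  rw [parity_mul_majorana i, neg_mul, mul_assoc, ← mul_assoc (parity n) (parity n),
    parity_mul_self, one_mul]

/-- The phases and parities cancel in pairs, so quadratic expressions do not see the identification.
-/
lemma systemField_mul (i j : Phase n) :
    systemField E i * systemField E j = majorana i * majorana j := by
  cases E
  · rfl
  · simp [systemField, smul_smul, majorana_parity_mul_majorana_parity]

lemma bathField_mul (i j : Phase n) :
    bathField E i * bathField E j = majorana i * majorana j := by
  cases E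
  · rfl
  · simp [bathField, smul_smul, parity_majorana_mul_parity_majorana]

lemma systemField_car (i j : Phase n) :
    systemField E i * systemField E j + systemField E j * systemField E i =
      if i = j then (2 : Op n) else 0 := by
  rw [systemField_mul, systemField_mul, majorana_car]

lemma bathField_car (i j : Phase n) :
    bathField E i * bathField E j + bathField E j * bathField E i =
      if i = j then (2 : Op n) else 0 := by
  rw [bathField_mul, bathField_mul, majorana_car]

lemma systemField_isHermitian (i : Phase n) : (systemField E i).IsHermitian := by
  cases E
  · exact majorana_isHermitian i
  · simp [Matrix.IsHermitian, systemField, Matrix.conjTranspose_smul, Matrix.conjTranspose_mul,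
      (majorana_isHermitian i).eq, parity_isHermitian.eq, majorana_mul_parity]

lemma parity_mul_systemField (i : Phase n) :
    parity n * systemField E i = -(systemField E i * parity n) := by
  cases E
  · exact parity_mul_majorana i
  · simp [systemField, ← mul_assoc, parity_mul_majorana]

lemma parity_mul_bathField (i : Phase n) :
    parity n * bathField E i = -(bathField E i * parity n) := by
  cases E
  · exact parity_mul_majorana i
  · simp [bathField, mul_assoc, majorana_mul_parity]

end Fields

variable {L K : ℕ}

lemma sum_kronecker {ι : Type*} (s : Finset ι) (f : ι → Op L) (B : Op K) :
    (∑ i ∈ s, f i) ⊗ₖ B = ∑ i ∈ s, f i ⊗ₖ B := by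
  ext a b
  simp [Matrix.sum_apply, Finset.sum_mul]

lemma kronecker_sum {ι : Type*} (s : Finset ι) (A : Op L) (f : ι → Op K) :
    A ⊗ₖ (∑ i ∈ s, f i) = ∑ i ∈ s, A ⊗ₖ f i := by
  ext a b
  simp [Matrix.sum_apply, Finset.mul_sum]

lemma systemMajorana_mul_systemMajorana (E : Identification) (i j : Phase L) :
    (systemMajorana E i * systemMajorana E j : BiOp L K) =
      (systemField E i * systemField E j) ⊗ₖ (1 : Op K) := by
  rw [systemField_mul]
  cases E <;> simp [systemMajorana, ← Matrix.mul_kronecker_mul, parity_mul_self]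

lemma bathMajorana_mul_bathMajorana (E : Identification) (i j : Phase K) :
    (bathMajorana E i * bathMajorana E j : BiOp L K) =
      (1 : Op L) ⊗ₖ (bathField E i * bathField E j) := by
  rw [bathField_mul]
  cases E <;> simp [bathMajorana, ← Matrix.mul_kronecker_mul, parity_mul_self]

/-- The fields are chosen to give this common form, after which the two identifications need no
separate treatment. -/
lemma systemMajorana_mul_bathMajorana (E : Identification) (i : Phase L) (j : Phase K) :
    (systemMajorana E i * bathMajorana E j : BiOp L K) =
      (systemField E i * parity L) ⊗ₖ bathField E j := by
  cases E
  · simp [systemMajorana, bathMajorana, systemField, bathField, ← Matrix.mul_kronecker_mul]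
  · simp only [systemMajorana, bathMajorana, systemField, bathField]
    rw [← Matrix.mul_kronecker_mul, smul_mul_assoc, Matrix.smul_kronecker, Matrix.kronecker_smul,
      smul_smul, mul_assoc, parity_mul_self]
    simp

namespace Model

variable (m : Model L K)

/-- The Hamiltonian of the system as an operator on `ℋ_S`. -/
noncomputable def sysH : Op L :=
  (1 / 2 : ℂ) • ∑ i, ∑ j, m.TS i j • (systemField m.E i * systemField m.E j)

/-- The Hamiltonian of a bath unit as an operator on `ℋ_B`. -/
noncomputable def bathH : Op K :=
  (1 / 2 : ℂ) • ∑ i, ∑ j, m.TB i j • (bathField m.E i * bathField m.E j)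

/-- The system operators in the interaction. -/
noncomputable def sysV (i : Phase L) : Op L := systemField m.E i * parity L

/-- The bath operators in the interaction. -/
noncomputable def bathV (i : Phase L) : Op K := ∑ j, m.Θ i j • bathField m.E j

lemma systemHamiltonian_eq : m.systemHamiltonian = m.sysH ⊗ₖ (1 : Op K) := by
  simp only [systemHamiltonian, sysH, systemMajorana_mul_systemMajorana, Matrix.smul_kronecker,
    sum_kronecker]

lemma bathHamiltonian_eq : m.bathHamiltonian = (1 : Op L) ⊗ₖ m.bathH := by
  simp only [bathHamiltonian, bathH, bathMajorana_mul_bathMajorana, Matrix.kronecker_smul,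
    kronecker_sum]

lemma interaction_eq : m.interaction = ∑ i, m.sysV i ⊗ₖ m.bathV i := by
  simp only [interaction, sysV, bathV, systemMajorana_mul_bathMajorana, Matrix.kronecker_smul,
    kronecker_sum]

/-! Self-adjointness of the Hamiltonian. -/

lemma systemMajorana_isHermitian (E : Identification) (i : Phase L) :
    (systemMajorana E i : BiOp L K).IsHermitian := by
  cases E <;> simp [Matrix.IsHermitian, systemMajorana, Matrix.conjTranspose_kronecker,
    (majorana_isHermitian i).eq, parity_isHermitian.eq]

lemma bathMajorana_isHermitian (E : Identification) (i : Phase K) :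
    (bathMajorana E i : BiOp L K).IsHermitian := by
  cases E <;> simp [Matrix.IsHermitian, bathMajorana, Matrix.conjTranspose_kronecker,
    (majorana_isHermitian i).eq, parity_isHermitian.eq]

/-- This sign compensates the conjugation of the imaginary `Θ` and makes the interaction
self-adjoint. -/
lemma bathMajorana_mul_systemMajorana (E : Identification) (i : Phase L) (j : Phase K) :
    (bathMajorana E j * systemMajorana E i : BiOp L K) =
      -(systemMajorana E i * bathMajorana E j) := by
  cases E
  · rw [systemMajorana, bathMajorana, ← Matrix.mul_kronecker_mul, ← Matrix.mul_kronecker_mul,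
      parity_mul_majorana]
    ext ⟨a, b⟩ ⟨c, d⟩
    simp
  · rw [systemMajorana, bathMajorana, ← Matrix.mul_kronecker_mul, ← Matrix.mul_kronecker_mul,
      parity_mul_majorana]
    ext ⟨a, b⟩ ⟨c, d⟩
    simp

lemma sum_mul_isHermitian {ι κ : Type*} [Fintype ι] [Fintype κ] [DecidableEq κ] (T : Matrix ι ι ℂ)
    (hT : T.IsHermitian) (a : ι → Matrix κ κ ℂ) (ha : ∀ i, (a i).IsHermitian) :
    (∑ i, ∑ j, T i j • (a i * a j)).IsHermitian := by
  simp only [Matrix.IsHermitian, Matrix.conjTranspose_sum, Matrix.conjTranspose_smul,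
    Matrix.conjTranspose_mul, (ha _).eq, hT.apply]
  exact Finset.sum_comm

lemma TB_isHermitian : m.TB.IsHermitian := by
  ext i j
  have := congrFun (congrFun m.RB_antisymm i) j
  simp only [Matrix.transpose_apply, Matrix.neg_apply] at this
  simp [TB, this]

lemma isHermitian_half_smul {κ : Type*} {A : Matrix κ κ ℂ} (hA : A.IsHermitian) :
    ((1 / 2 : ℂ) • A).IsHermitian := by
  simp [Matrix.IsHermitian, Matrix.conjTranspose_smul, hA.eq]

lemma totalHamiltonian_isHermitian (τ : ℝ) : (m.totalHamiltonian τ).IsHermitian := by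
  refine Matrix.IsHermitian.add (Matrix.IsHermitian.add ?_ ?_) ?_
  · exact isHermitian_half_smul (sum_mul_isHermitian _ m.TS_isHermitian _
      (systemMajorana_isHermitian _))
  · have : m.interaction.IsHermitian := by
      simp [Matrix.IsHermitian, interaction, Matrix.conjTranspose_sum, Matrix.conjTranspose_smul,
        Matrix.conjTranspose_mul, (systemMajorana_isHermitian _ _).eq, Θ,
        (bathMajorana_isHermitian _ _).eq, bathMajorana_mul_systemMajorana]
    rw [Matrix.IsHermitian, Matrix.conjTranspose_smul, this.eq]
    simp
  · exact isHermitian_half_smul (sum_mul_isHermitian _ m.TB_isHermitian _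
      (bathMajorana_isHermitian _))

end Model

/-! ### Quasi-free states -/

section States

variable {n : ℕ}

lemma isClosed_setOf_isState : IsClosed {ρ : Op n | IsState ρ} := by
  have h : {ρ : Op n | IsState ρ} = {ρ | ρ.conjTranspose = ρ} ∩
      (⋂ x : Finset (Fin n) → ℂ, {ρ | 0 ≤ star x ⬝ᵥ ρ.mulVec x}) ∩ {ρ | ρ.trace = 1} := by
    ext ρ
    simp [IsState, Matrix.posSemidef_iff_dotProduct_mulVec, Matrix.IsHermitian]
  rw [h]
  refine (IsClosed.inter ?_ (isClosed_iInter fun x => ?_)).inter ?_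
  · exact isClosed_eq (by fun_prop) continuous_id
  · exact isClosed_le continuous_const (by fun_prop)
  · exact isClosed_eq (by fun_prop) continuous_const

lemma IsGaussian.isState {ρ : Op n} (h : IsGaussian ρ) : IsState ρ := by
  obtain ⟨β, H, ⟨hH, -⟩, rfl⟩ := h
  set A : Op n := ((-β : ℂ) • H) with hA
  have hAH : A.IsHermitian := by
    simp [hA, Matrix.IsHermitian, Matrix.conjTranspose_smul, hH.eq]
  have hP : (NormedSpace.exp A).PosSemidef := by
    -- Positivity comes from exp A = (exp(A/2))* exp(A/2).
    have h1 : A = (1 / 2 : ℂ) • A + (1 / 2 : ℂ) • A := by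
      rw [← add_smul]; norm_num
    have h2 := Model.isHermitian_half_smul hAH
    rw [h1, Matrix.exp_add_of_commute _ _ (Commute.refl _)]
    nth_rewrite 1 [← h2.exp.eq]
    exact Matrix.posSemidef_conjTranspose_mul_self _
  have hD : (NormedSpace.exp A).PosDef := hP.posDef_iff_isUnit.mpr (Matrix.isUnit_exp A)
  have htr : 0 < (NormedSpace.exp A).trace := hD.trace_pos
  refine ⟨hP.smul (inv_nonneg.mpr htr.le), ?_⟩
  rw [Matrix.trace_smul, smul_eq_mul, inv_mul_cancel₀ htr.ne']

lemma parity_mul_quadratic (T : Matrix (Phase n) (Phase n) ℂ) :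
    Commute (parity n) (quadratic T) := by
  refine Commute.sum_right _ _ _ fun i _ => Commute.sum_right _ _ _ fun j _ => ?_
  refine Commute.smul_right ?_ _
  rw [Commute, SemiconjBy, ← mul_assoc, parity_mul_majorana, neg_mul, mul_assoc,
    parity_mul_majorana, mul_neg, neg_neg, mul_assoc]

lemma IsGaussian.parity_commute {ρ : Op n} (h : IsGaussian ρ) : parity n * ρ = ρ * parity n := by
  obtain ⟨β, H, ⟨-, T, rfl⟩, rfl⟩ := h
  rw [Matrix.mul_smul, Matrix.smul_mul]
  congr 1
  open scoped Matrix.Norms.L2Operator in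
  have h1 : Commute (parity n) (NormedSpace.exp ((-β : ℂ) • quadratic T)) :=
    ((parity_mul_quadratic T).smul_right _).exp_right
  exact h1

lemma IsQuasiFree.isState {ρ : Op n} (h : IsQuasiFree ρ) : IsState ρ :=
  closure_minimal (fun _ hσ => IsGaussian.isState hσ) isClosed_setOf_isState h

lemma IsQuasiFree.parity_commute {ρ : Op n} (h : IsQuasiFree ρ) :
    parity n * ρ = ρ * parity n := by
  have hc : IsClosed {σ : Op n | parity n * σ = σ * parity n} :=
    isClosed_eq (by fun_prop) (by fun_prop)
  exact closure_minimal (fun _ hσ => IsGaussian.parity_commute hσ) hc h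

/-- Conjugation by parity fixes the state and flips the sign of the field. This removes the terms of
order √τ. -/
lemma IsQuasiFree.trace_mul_bathField {ρ : Op n} (h : IsQuasiFree ρ) (E : Identification)
    (j : Phase n) : (ρ * bathField E j).trace = 0 := by
  have h1 : (ρ * bathField E j).trace = -(ρ * bathField E j).trace := by
    calc (ρ * bathField E j).trace = (parity n * parity n * (ρ * bathField E j)).trace := by
          rw [parity_mul_self, one_mul]
      _ = (ρ * (parity n * bathField E j) * parity n).trace := by
          rw [Matrix.mul_assoc, Matrix.trace_mul_comm, ← Matrix.mul_assoc (parity n),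
            h.parity_commute, Matrix.mul_assoc ρ]
      _ = -(ρ * bathField E j).trace := by
          rw [parity_mul_bathField, mul_neg, neg_mul, Matrix.trace_neg, Matrix.mul_assoc,
            Matrix.mul_assoc, parity_mul_self, Matrix.mul_one]
  exact self_eq_neg.mp h1

end States

/-! ### Second-order expansion of one interaction -/

section Expansion

open Asymptotics Filter

lemma exp_expansion_isBigO {𝔸 : Type*} [NormedRing 𝔸] [NormedAlgebra ℂ 𝔸] [CompleteSpace 𝔸]
    (a b : 𝔸) :
    (fun s : ℝ => NormedSpace.exp ((s : ℂ) • a + (s : ℂ) ^ 2 • b) -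
      (1 + (s : ℂ) • a + (s : ℂ) ^ 2 • (b + (1 / 2 : ℂ) • (a * a)))) =O[𝓝 0]
      fun s : ℝ => s ^ 3 := by
  set y : ℝ → 𝔸 := fun s => (s : ℂ) • a + (s : ℂ) ^ 2 • b with hy
  have hyc : Continuous y := by fun_prop
  have hy0 : Tendsto y (𝓝 0) (𝓝 0) := by
    have := hyc.tendsto 0
    simpa [hy] using this
  have hyO : y =O[𝓝 0] fun s : ℝ => s := by
    have h1 : y = fun s : ℝ => s • (a + (s : ℂ) • b) := by
      funext s
      rw [hy, ← Complex.coe_smul]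
      module
    rw [h1]
    have h2 : (fun s : ℝ => a + (s : ℂ) • b) =O[𝓝 0] fun _ : ℝ => (1 : ℝ) :=
      (Continuous.tendsto (by fun_prop) 0).isBigO_one ℝ
    simpa using (isBigO_refl (fun s : ℝ => s) (𝓝 0)).smul h2
  have h1 := ((NormedSpace.exp_hasFPowerSeriesAt_zero (𝕂 := ℂ)
    (𝔸 := 𝔸)).isBigO_sub_partialSum_pow 3).comp_tendsto hy0
  have h2 : (fun s : ℝ => ‖y s‖ ^ 3) =O[𝓝 0] fun s : ℝ => s ^ 3 := hyO.norm_left.pow 3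
  have h3 := h1.trans h2
  -- These are the terms of order s³ and s⁴ in half the square of the exponent; they go into the
  -- remainder.
  have h4 : (fun s : ℝ => (s : ℂ) ^ 3 • ((1 / 2 : ℂ) • (a * b + b * a) +
      ((1 / 2 : ℂ) * s) • (b * b))) =O[𝓝 0] fun s : ℝ => s ^ 3 := by
    have h5 : (fun s : ℝ => (1 / 2 : ℂ) • (a * b + b * a) +
      ((1 / 2 : ℂ) * s) • (b * b)) =O[𝓝 0] fun _ : ℝ => (1 : ℝ) :=
      (Continuous.tendsto (by fun_prop) 0).isBigO_one ℝ
    have h6 : (fun s : ℝ => (s : ℂ) ^ 3) =O[𝓝 0] fun s : ℝ => s ^ 3 :=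
      IsBigO.of_bound 1 (Eventually.of_forall fun s => by simp)
    simpa using h6.smul h5
  refine (h3.add h4).congr_left fun s => ?_
  simp only [Function.comp, zero_add, FormalMultilinearSeries.partialSum,
    NormedSpace.expSeries_apply_eq, Finset.sum_range_succ, Finset.sum_range_zero, pow_zero,
    pow_one, Nat.factorial]
  simp only [hy, pow_two (_ : 𝔸), mul_add, add_mul, smul_mul_assoc, mul_smul_comm]
  norm_num
  module

lemma bilinear_expansion_isBigO {E F G : Type*} [NormedAddCommGroup E] [NormedSpace ℂ E]
    [NormedAddCommGroup F] [NormedSpace ℂ F] [NormedAddCommGroup G] [NormedSpace ℂ G]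
    (Ψ : E →L[ℂ] F →L[ℂ] G) {P : ℝ → E} {Q : ℝ → F} {a₀ a₁ a₂ : E} {b₀ b₁ b₂ : F}
    (hP : (fun s : ℝ => P s - (a₀ + (s : ℂ) • a₁ + (s : ℂ) ^ 2 • a₂)) =O[𝓝 0] fun s : ℝ => s ^ 3)
    (hQ : (fun s : ℝ => Q s - (b₀ + (s : ℂ) • b₁ + (s : ℂ) ^ 2 • b₂)) =O[𝓝 0] fun s : ℝ => s ^ 3) :
    (fun s : ℝ => Ψ (P s) (Q s) - (Ψ a₀ b₀ + (s : ℂ) • (Ψ a₁ b₀ + Ψ a₀ b₁) +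
      (s : ℂ) ^ 2 • (Ψ a₂ b₀ + Ψ a₁ b₁ + Ψ a₀ b₂))) =O[𝓝 0] fun s : ℝ => s ^ 3 := by
  set p : ℝ → E := fun s => a₀ + (s : ℂ) • a₁ + (s : ℂ) ^ 2 • a₂ with hp
  set q : ℝ → F := fun s => b₀ + (s : ℂ) • b₁ + (s : ℂ) ^ 2 • b₂ with hq
  have hp1 : p =O[𝓝 0] fun _ : ℝ => (1 : ℝ) :=
    (Continuous.tendsto (by fun_prop) 0).isBigO_one ℝ
  have hq1 : q =O[𝓝 0] fun _ : ℝ => (1 : ℝ) :=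
    (Continuous.tendsto (by fun_prop) 0).isBigO_one ℝ
  have hs1 : (fun s : ℝ => s ^ 3) =O[𝓝 0] fun _ : ℝ => (1 : ℝ) :=
    (Continuous.tendsto (by fun_prop) 0).isBigO_one ℝ
  have hQ1 : Q =O[𝓝 0] fun _ : ℝ => (1 : ℝ) := by
    refine ((hQ.trans hs1).add hq1).congr_left fun s => by simp only [hq, sub_add_cancel]
  have h1 : (fun s => Ψ (P s - p s) (Q s)) =O[𝓝 0] fun s : ℝ => s ^ 3 := by
    refine (Ψ.isBoundedBilinearMap.isBigO_comp).trans ?_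
    simpa only [mul_one] using hP.norm_left.mul hQ1.norm_left
  have h2 : (fun s => Ψ (p s) (Q s - q s)) =O[𝓝 0] fun s : ℝ => s ^ 3 := by
    refine (Ψ.isBoundedBilinearMap.isBigO_comp).trans ?_
    simpa only [one_mul] using hp1.norm_left.mul hQ.norm_left
  have h4 : (fun s : ℝ => (s : ℂ) ^ 3 • ((Ψ a₁ b₂ + Ψ a₂ b₁) + (s : ℂ) • Ψ a₂ b₂)) =O[𝓝 0]
      fun s : ℝ => s ^ 3 := by
    have h5 : (fun s : ℝ => (Ψ a₁ b₂ + Ψ a₂ b₁) + (s : ℂ) • Ψ a₂ b₂) =O[𝓝 0]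
        fun _ : ℝ => (1 : ℝ) :=
      (Continuous.tendsto (by fun_prop) 0).isBigO_one ℝ
    have h6 : (fun s : ℝ => (s : ℂ) ^ 3) =O[𝓝 0] fun s : ℝ => s ^ 3 :=
      IsBigO.of_bound 1 (Eventually.of_forall fun s => by simp)
    simpa using h6.smul h5
  refine ((h1.add h2).add h4).congr_left fun s => ?_
  simp only [map_sub, _root_.sub_apply, hp, hq, map_add, map_smul, _root_.add_apply,
    _root_.smul_apply]
  module

end Expansion

/-! ### The generator -/

section Generator

open scoped Matrix.Norms.L2Operator

variable {L K : ℕ}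

lemma partialTrace_add (A B : BiOp L K) :
    partialTrace (A + B) = partialTrace A + partialTrace B := by
  ext s t; simp [partialTrace, Finset.sum_add_distrib]

lemma partialTrace_smul (c : ℂ) (A : BiOp L K) :
    partialTrace (c • A) = c • partialTrace A := by
  ext s t; simp [partialTrace, Finset.mul_sum]

lemma partialTrace_kronecker (A : Op L) (B : Op K) :
    partialTrace (A ⊗ₖ B) = B.trace • A := by
  ext s t; simp [partialTrace, Matrix.trace, ← Finset.mul_sum, mul_comm]

lemma partialTrace_sum {ι : Type*} (s : Finset ι) (f : ι → BiOp L K) :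
    partialTrace (∑ i ∈ s, f i) = ∑ i ∈ s, partialTrace (f i) := by
  ext a b
  simp only [partialTrace, Matrix.sum_apply, Matrix.of_apply]
  exact Finset.sum_comm

/-- The map `ρ ↦ Tr_B (A (ρ ⊗ ω) B)`. -/
noncomputable def sandwich (ω : Op K) (A B : BiOp L K) : Op L →L[ℂ] Op L :=
  LinearMap.toContinuousLinearMap
    { toFun := fun ρ => partialTrace (A * (ρ ⊗ₖ ω) * B)
      map_add' := fun x y => by
        rw [Matrix.add_kronecker, mul_add, add_mul, partialTrace_add]
      map_smul' := fun c x => by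
        rw [Matrix.smul_kronecker, mul_smul_comm, smul_mul_assoc, partialTrace_smul,
          RingHom.id_apply] }

lemma sandwich_apply (ω : Op K) (A B : BiOp L K) (ρ : Op L) :
    sandwich ω A B ρ = partialTrace (A * (ρ ⊗ₖ ω) * B) := rfl

lemma sandwich_smul_left (ω : Op K) (c : ℂ) (A B : BiOp L K) :
    sandwich ω (c • A) B = c • sandwich ω A B := by
  ext1 ρ
  simp only [sandwich_apply, _root_.smul_apply, smul_mul_assoc, partialTrace_smul]

lemma sandwich_smul_right (ω : Op K) (c : ℂ) (A B : BiOp L K) :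
    sandwich ω A (c • B) = c • sandwich ω A B := by
  ext1 ρ
  simp only [sandwich_apply, _root_.smul_apply, mul_smul_comm, partialTrace_smul]

/-- The map `ρ ↦ Tr_B (A (ρ ⊗ ω) B)` as a bilinear function of `A` and `B`. -/
noncomputable def sandwichBilin (ω : Op K) : BiOp L K →L[ℂ] BiOp L K →L[ℂ] (Op L →L[ℂ] Op L) :=
  LinearMap.toContinuousBilinearMap
    (LinearMap.mk₂ ℂ (sandwich ω)
      (fun A A' B => by
        ext1 ρ; simp only [sandwich_apply, _root_.add_apply, add_mul, partialTrace_add])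
      (sandwich_smul_left ω)
      (fun A B B' => by
        ext1 ρ; simp only [sandwich_apply, _root_.add_apply, mul_add, partialTrace_add])
      (sandwich_smul_right ω))

lemma sandwichBilin_apply (ω : Op K) (A B : BiOp L K) : sandwichBilin ω A B = sandwich ω A B := rfl

namespace Model

variable (m : Model L K)

/-- The generator of the limiting semigroup. -/
noncomputable def generator : Op L →L[ℂ] Op L :=
  sandwich m.ω ((-Complex.I) • (m.systemHamiltonian + m.bathHamiltonian) +
      (1 / 2 : ℂ) • ((-Complex.I) • m.interaction * (-Complex.I) • m.interaction)) 1 +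
    sandwich m.ω ((-Complex.I) • m.interaction) (Complex.I • m.interaction) +
    sandwich m.ω 1 (Complex.I • (m.systemHamiltonian + m.bathHamiltonian) +
      (1 / 2 : ℂ) • (Complex.I • m.interaction * Complex.I • m.interaction))

/-- One interaction as a continuous linear map. -/
noncomputable def stepCLM (τ : ℝ) : Op L →L[ℂ] Op L :=
  sandwich m.ω (NormedSpace.exp ((-(Complex.I * (τ : ℂ))) • m.totalHamiltonian τ))
    (NormedSpace.exp ((Complex.I * (τ : ℂ)) • m.totalHamiltonian τ))

lemma stepCLM_pow_apply (τ : ℝ) (n : ℕ) (ρ : Op L) :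
    (m.stepCLM τ ^ n) ρ = (m.step τ)^[n] ρ := by
  rw [FunLike.coe_pow_eq_iterate]
  rfl

lemma trace_ω : m.ω.trace = 1 := m.ω_quasiFree.isState.2

lemma sandwich_one_one : sandwich m.ω (1 : BiOp L K) 1 = 1 := by
  ext1 ρ
  simp [sandwich_apply, partialTrace_kronecker, trace_ω]

lemma trace_ω_mul_bathV (i : Phase L) : (m.ω * m.bathV i).trace = 0 := by
  simp only [bathV, Finset.mul_sum, Matrix.mul_smul, Matrix.trace_sum, Matrix.trace_smul,
    m.ω_quasiFree.trace_mul_bathField, smul_zero, Finset.sum_const_zero]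

lemma sandwich_interaction_left (c : ℂ) (ρ : Op L) :
    sandwich m.ω (c • m.interaction) 1 ρ = 0 := by
  rw [sandwich_apply, mul_one, smul_mul_assoc, partialTrace_smul, interaction_eq, Finset.sum_mul, partialTrace_sum,
    Finset.sum_eq_zero, smul_zero]
  intro i _
  rw [← Matrix.mul_kronecker_mul, partialTrace_kronecker, Matrix.trace_mul_comm,
    trace_ω_mul_bathV, zero_smul]

lemma sandwich_interaction_right (c : ℂ) (ρ : Op L) :
    sandwich m.ω 1 (c • m.interaction) ρ = 0 := by
  rw [sandwich_apply, one_mul, mul_smul_comm, partialTrace_smul, interaction_eq, Finset.mul_sum, partialTrace_sum,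
    Finset.sum_eq_zero, smul_zero]
  intro i _
  rw [← Matrix.mul_kronecker_mul, partialTrace_kronecker, trace_ω_mul_bathV, zero_smul]

-- Substitute s = √τ in the expansions of the two exponentials: the first-order terms vanish, the
-- second-order ones form the generator, and the remainder τ^{3/2} is o(τ).
open Asymptotics Filter in
lemma stepCLM_isLittleO :
    (fun τ : ℝ => m.stepCLM τ - 1 - (τ : ℂ) • m.generator) =o[𝓝[>] 0] fun τ : ℝ => τ := by
  have hP := exp_expansion_isBigO (𝔸 := BiOp L K) ((-Complex.I) • m.interaction)
    ((-Complex.I) • (m.systemHamiltonian + m.bathHamiltonian))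
  have hQ := exp_expansion_isBigO (𝔸 := BiOp L K) (Complex.I • m.interaction)
    (Complex.I • (m.systemHamiltonian + m.bathHamiltonian))
  have h := bilinear_expansion_isBigO (E := BiOp L K) (F := BiOp L K)
    (G := Op L →L[ℂ] Op L) (sandwichBilin m.ω) hP hQ
  have hsqrt : Tendsto (fun τ : ℝ => √τ) (𝓝[>] 0) (𝓝 0) := by
    have := Real.continuous_sqrt.tendsto 0
    rw [Real.sqrt_zero] at this
    exact this.mono_left nhdsWithin_le_nhds
  have h1 := h.comp_tendsto hsqrt
  have h2 : (fun τ : ℝ => √τ ^ 3) =o[𝓝[>] 0] fun τ : ℝ => τ := by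
    have h3 : (fun τ : ℝ => √τ * τ) =o[𝓝[>] 0] fun τ : ℝ => 1 * τ :=
      ((isLittleO_one_iff ℝ).mpr hsqrt).mul_isBigO (isBigO_refl _ _)
    refine h3.congr' ?_ (by simp)
    filter_upwards [self_mem_nhdsWithin] with τ hτ
    rw [pow_succ', Real.sq_sqrt (le_of_lt hτ)]
  refine (h1.trans_isLittleO h2).congr' ?_ EventuallyEq.rfl
  filter_upwards [self_mem_nhdsWithin] with τ hτ
  have hτ' : 0 < τ := hτ
  have hs : ((√τ : ℝ) : ℂ) ^ 2 = τ := by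
    rw [← Complex.ofReal_pow, Real.sq_sqrt hτ'.le]
  have hH (z : ℂ) : ((√τ : ℝ) : ℂ) • z • m.interaction +
      ((√τ : ℝ) : ℂ) ^ 2 • z • (m.systemHamiltonian + m.bathHamiltonian) =
      (z * τ) • m.totalHamiltonian τ := by
    have h4 : (τ : ℂ) * ((1 / √τ : ℝ) : ℂ) = ((√τ : ℝ) : ℂ) := by
      rw [← Complex.ofReal_mul, mul_one_div, Real.div_sqrt]
    rw [totalHamiltonian, hs, smul_add (z * (τ : ℂ)), smul_add (z * (τ : ℂ)),
      smul_smul (z * (τ : ℂ)), mul_assoc z, h4]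
    module
  simp only [Function.comp, hH, sandwichBilin_apply]
  have hfirst : sandwich m.ω ((-Complex.I) • m.interaction) 1 +
      sandwich m.ω 1 (Complex.I • m.interaction) = 0 := by
    ext1 ρ
    rw [_root_.add_apply, sandwich_interaction_left, sandwich_interaction_right, add_zero]
    rfl
  rw [hfirst, hs, sandwich_one_one, smul_zero, add_zero, stepCLM, neg_mul, ← sub_sub]
  rfl

/-- The limiting semigroup. -/
noncomputable def semigroup (t : ℝ) (ρ : Op L) : Op L :=
  NormedSpace.exp ((t : ℂ) • m.generator) ρ

theorem isContinuousTimeLimit_semigroup : m.IsContinuousTimeLimit m.semigroup := by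
  intro t ht ρ
  have h := tendsto_pow_floor_exp (𝔸 := Op L →L[ℂ] Op L) m.stepCLM_isLittleO ht
  have h2 := ((ContinuousLinearMap.apply ℂ (Op L) ρ).continuous.tendsto _).comp h
  simp only [Function.comp_def, ContinuousLinearMap.apply_apply, stepCLM_pow_apply] at h2
  exact h2

lemma IsContinuousTimeLimit.eq_semigroup {Λ : ℝ → Op L → Op L} (h : m.IsContinuousTimeLimit Λ)
    {t : ℝ} (ht : 0 ≤ t) (ρ : Op L) : Λ t ρ = m.semigroup t ρ :=
  tendsto_nhds_unique (h t ht ρ) (m.isContinuousTimeLimit_semigroup t ht ρ)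

/-! The evolution preserves states. -/

lemma step_isState {τ : ℝ} {ρ : Op L} (hρ : IsState ρ) : IsState (m.step τ ρ) := by
  set U := NormedSpace.exp ((-(Complex.I * (τ : ℂ))) • m.totalHamiltonian τ) with hU
  have hUs : NormedSpace.exp ((Complex.I * (τ : ℂ)) • m.totalHamiltonian τ) = U.conjTranspose := by
    rw [hU, ← Matrix.exp_conjTranspose, Matrix.conjTranspose_smul,
      (m.totalHamiltonian_isHermitian τ).eq]
    simp
  have hUU : NormedSpace.exp ((Complex.I * (τ : ℂ)) • m.totalHamiltonian τ) * U = 1 := by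
    have h := Matrix.exp_add_of_commute ((Complex.I * (τ : ℂ)) • m.totalHamiltonian τ)
      (-((Complex.I * (τ : ℂ)) • m.totalHamiltonian τ)) (Commute.neg_right (Commute.refl _))
    rw [hU, neg_smul, ← h, add_neg_cancel, NormedSpace.exp_zero]
  have hstep : m.step τ ρ = partialTrace (U * (ρ ⊗ₖ m.ω) * U.conjTranspose) := by
    rw [step, hUs]
  have hpsd : (U * (ρ ⊗ₖ m.ω) * U.conjTranspose).PosSemidef :=
    (hρ.1.kronecker m.ω_quasiFree.isState.1).mul_mul_conjTranspose_same U
  constructor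
  · rw [hstep]
    have : partialTrace (U * (ρ ⊗ₖ m.ω) * U.conjTranspose) =
        ∑ b, (U * (ρ ⊗ₖ m.ω) * U.conjTranspose).submatrix (fun s => (s, b)) (fun s => (s, b)) := by
      ext s t; simp [partialTrace, Matrix.sum_apply]
    rw [this]
    exact Matrix.posSemidef_sum _ fun b _ => hpsd.submatrix _
  · have htr (A : BiOp L K) : (partialTrace A).trace = A.trace := by
      simp [partialTrace, Matrix.trace, Fintype.sum_prod_type]
    rw [hstep, htr, Matrix.trace_mul_comm, ← hUs, ← mul_assoc, hUU, one_mul,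
      Matrix.trace_kronecker, hρ.2, m.trace_ω, one_mul]

lemma semigroup_isState {t : ℝ} (ht : 0 ≤ t) {ρ : Op L} (hρ : IsState ρ) :
    IsState (m.semigroup t ρ) := by
  refine isClosed_setOf_isState.mem_of_tendsto (m.isContinuousTimeLimit_semigroup t ht ρ)
    (Filter.Eventually.of_forall fun τ => ?_)
  generalize ⌊t / τ⌋₊ = n
  induction n with
  | zero => exact hρ
  | succ n ih =>
    rw [Function.iterate_succ_apply']
    exact m.step_isState ih

end Model

end Generator

/-! ### The dual generator in terms of raising and lowering operators -/

section Raising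

variable {n : ℕ} (E : Identification)

/-- The raising superoperator `X ↦ ½ (αᵢ X + P X P αᵢ)`. -/
noncomputable def raising (i : Phase n) : Op n →ₗ[ℂ] Op n :=
  (1 / 2 : ℂ) • (LinearMap.mulLeft ℂ (systemField E i) +
    LinearMap.mulRight ℂ (parity n * systemField E i) ∘ₗ LinearMap.mulLeft ℂ (parity n))

/-- The lowering superoperator `X ↦ ½ (αᵢ X - P X P αᵢ)`. -/
noncomputable def lowering (i : Phase n) : Op n →ₗ[ℂ] Op n :=
  (1 / 2 : ℂ) • (LinearMap.mulLeft ℂ (systemField E i) -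
    LinearMap.mulRight ℂ (parity n * systemField E i) ∘ₗ LinearMap.mulLeft ℂ (parity n))

lemma raising_apply (i : Phase n) (X : Op n) :
    raising E i X = (1 / 2 : ℂ) • (systemField E i * X +
      parity n * X * (parity n * systemField E i)) := rfl

lemma lowering_apply (i : Phase n) (X : Op n) :
    lowering E i X = (1 / 2 : ℂ) • (systemField E i * X -
      parity n * X * (parity n * systemField E i)) := rfl

/-- The map `X ↦ αᵢ P X αⱼ P`. -/
noncomputable def twistedSandwich (i j : Phase n) (X : Op n) : Op n :=
  systemField E i * parity n * X * (systemField E j * parity n)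

lemma parity_mul_systemField_mul (i : Phase n) (Y : Op n) :
    parity n * (systemField E i * Y) = -(systemField E i * (parity n * Y)) := by
  rw [← mul_assoc, parity_mul_systemField, neg_mul, mul_assoc]

lemma parity_mul_parity_mul (Y : Op n) : parity n * (parity n * Y) = Y := by
  rw [← mul_assoc, parity_mul_self, one_mul]

/-- Every product of two of these maps is a combination of left products, right products and twisted
sandwiches; later identities are linear algebra in these terms. -/
lemma raising_lowering (i j : Phase n) (X : Op n) :
    raising E i (lowering E j X) = (1 / 4 : ℂ) • (systemField E i * systemField E j * X +
      X * (systemField E j * systemField E i) + twistedSandwich E i j X +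
        twistedSandwich E j i X) := by
  simp only [raising_apply, lowering_apply, twistedSandwich, mul_assoc, mul_sub,
    sub_mul, mul_smul_comm, smul_mul_assoc, parity_mul_systemField, parity_mul_systemField_mul,
    parity_mul_self, parity_mul_parity_mul, mul_neg, neg_mul, mul_one]
  module

lemma lowering_raising (i j : Phase n) (X : Op n) :
    lowering E i (raising E j X) = (1 / 4 : ℂ) • (systemField E i * systemField E j * X +
      X * (systemField E j * systemField E i) - twistedSandwich E i j X -
        twistedSandwich E j i X) := by
  simp only [raising_apply, lowering_apply, twistedSandwich, mul_assoc, mul_add, add_mul,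
    mul_smul_comm, smul_mul_assoc, parity_mul_systemField, parity_mul_systemField_mul,
    parity_mul_self, parity_mul_parity_mul, mul_neg, neg_mul, mul_one]
  module

lemma lowering_lowering (i j : Phase n) (X : Op n) :
    lowering E i (lowering E j X) = (1 / 4 : ℂ) • (systemField E i * systemField E j * X -
      X * (systemField E j * systemField E i) + twistedSandwich E i j X -
        twistedSandwich E j i X) := by
  simp only [lowering_apply, twistedSandwich, mul_assoc, mul_sub,
    sub_mul, mul_smul_comm, smul_mul_assoc, parity_mul_systemField, parity_mul_systemField_mul,
    parity_mul_self, parity_mul_parity_mul, mul_neg, neg_mul, mul_one]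
  module

/-- Written with a scalar multiple of 1, so that the anticommutation relation can be used under
`module`. -/
lemma systemField_mul_swap (i j : Phase n) :
    systemField E i * systemField E j =
      (if i = j then (2 : ℂ) else 0) • (1 : Op n) - systemField E j * systemField E i := by
  rw [eq_sub_iff_add_eq, systemField_car]
  split_ifs
  · rw [Algebra.smul_def, mul_one]; rfl
  · rw [zero_smul]

lemma lowering_anticomm (i j : Phase n) (X : Op n) :
    lowering E i (lowering E j X) = -lowering E j (lowering E i X) := by
  rw [lowering_lowering, lowering_lowering, systemField_mul_swap E i j, sub_mul, mul_sub,
    smul_mul_assoc, mul_smul_comm, one_mul, mul_one]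
  module

lemma lowering_raising_add (i j : Phase n) (X : Op n) :
    lowering E i (raising E j X) + raising E j (lowering E i X) = if i = j then X else 0 := by
  rw [lowering_raising, raising_lowering, systemField_mul_swap E i j, sub_mul, mul_sub,
    smul_mul_assoc, mul_smul_comm, one_mul, mul_one]
  split_ifs <;> module

end Raising

section EigenvalueOp

variable {n : ℕ}

/-- Adjointness for the Hilbert–Schmidt product: moving parity past the field turns the minus of one
map into the plus of the other. -/
lemma trace_mul_lowering_conjTranspose (E : Identification) (i : Phase n) (x y : Op n) :
    (y * (lowering E i x).conjTranspose).trace = (raising E i y * x.conjTranspose).trace := by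
  simp only [lowering_apply, raising_apply, Matrix.conjTranspose_smul, Matrix.conjTranspose_sub,
    Matrix.conjTranspose_mul, (systemField_isHermitian E i).eq, parity_isHermitian.eq,
    mul_smul_comm, smul_mul_assoc, Matrix.trace_smul, mul_sub, add_mul, Matrix.trace_sub,
    Matrix.trace_add]
  have h1 : (y * (x.conjTranspose * systemField E i)).trace =
      (systemField E i * y * x.conjTranspose).trace := by
    rw [← mul_assoc, Matrix.trace_mul_comm, mul_assoc]
  have h2 : (y * (systemField E i * parity n * (x.conjTranspose * parity n))).trace =
      -(parity n * y * (parity n * systemField E i) * x.conjTranspose).trace := by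
    rw [← mul_assoc, ← mul_assoc, Matrix.trace_mul_comm, parity_mul_systemField, mul_neg, neg_mul,
      Matrix.trace_neg, neg_neg]
    simp only [mul_assoc]
  rw [h1, h2, sub_neg_eq_add]
  simp

/-- `eigenvalue_eq_zero_of_re_eq_zero` for the raising and lowering superoperators. -/
theorem quadOp_eigenvalue_eq_zero (E : Identification) {κ : Type*} [Fintype κ]
    {R : Matrix (Phase n) (Phase n) ℂ} {W : Matrix (Phase n) κ ℂ} (hR : R.conjTranspose = -R)
    (hW : W.conjTranspose = W.transpose)
    (hker : ∀ x : Phase n → ℂ, (∀ k, W.transpose.mulVec ((R ^ k).mulVec x) = 0) → R.mulVec x = 0)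
    (Y : Matrix (Phase n) (Phase n) ℂ) {c : ℂ} (hc : c.re = 0) {X : Op n} (hX0 : X ≠ 0)
    (hX : quadOp (raising E) (lowering E) (-(2 : ℂ) • R - (2 : ℂ) • (W * W.transpose)) X +
      quadOp (lowering E) (lowering E) Y X = c • X) : c = 0 := by
  -- Weight 1 gives the Hilbert–Schmidt inner product tr(y x*).
  let : NormedAddCommGroup (Op n) := Matrix.toMatrixNormedAddCommGroup 1 Matrix.PosDef.one
  let : InnerProductSpace ℂ (Op n) := Matrix.toMatrixInnerProductSpace 1 Matrix.PosSemidef.one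
  refine eigenvalue_eq_zero_of_re_eq_zero (V := Op n) (C := raising E) (D := lowering E) ?_
    (lowering_anticomm E) (lowering_raising_add E) hR hW hker Y hc hX0 hX
  intro i x y
  change (y * 1 * (lowering E i x).conjTranspose).trace = (raising E i y * 1 * x.conjTranspose).trace
  rw [mul_one, mul_one, trace_mul_lowering_conjTranspose]

end EigenvalueOp

/-! ### The generator in Lindblad form and its dual -/

section Dual

variable {L K : ℕ}

namespace Model

variable (m : Model L K)

/-- The bath correlations `tr (ω Bᵢ Bₖ)`. -/
noncomputable def corr : Matrix (Phase L) (Phase L) ℂ :=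
  Matrix.of fun i k => (m.ω * (m.bathV i * m.bathV k)).trace

lemma corr_apply (i k : Phase L) : m.corr i k = (m.ω * (m.bathV i * m.bathV k)).trace := rfl

/-- The anticommutator of two bath operators is a scalar, so the symmetric part of the correlations
does not depend on ω; the minus sign is i² from Θ = iW. -/
lemma corr_add_transpose :
    m.corr + m.corr.transpose = -((2 : ℂ) • (m.Wc * m.Wc.transpose)) := by
  ext i k
  have h : m.bathV i * m.bathV k + m.bathV k * m.bathV i =
      (∑ j, m.Θ i j * m.Θ k j * 2) • (1 : Op K) := by
    have h1 : m.bathV k * m.bathV i =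
        ∑ j, ∑ l, (m.Θ i j * m.Θ k l) • (bathField m.E l * bathField m.E j) := by
      simp only [bathV, Finset.sum_mul, Finset.mul_sum, smul_mul_assoc, mul_smul_comm, smul_smul,
        Finset.smul_sum]
    have h2 : m.bathV i * m.bathV k =
        ∑ j, ∑ l, (m.Θ i j * m.Θ k l) • (bathField m.E j * bathField m.E l) := by
      simp only [bathV, Finset.sum_mul, Finset.mul_sum, smul_mul_assoc, mul_smul_comm, smul_smul,
        Finset.smul_sum]
      rw [Finset.sum_comm]
      exact Finset.sum_congr rfl fun j _ => Finset.sum_congr rfl fun l _ => by rw [mul_comm]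
    rw [h1, h2, ← Finset.sum_add_distrib, Finset.sum_smul]
    refine Finset.sum_congr rfl fun j _ => ?_
    simp only [← Finset.sum_add_distrib, ← smul_add, bathField_car, smul_ite, smul_zero,
      Finset.sum_ite_eq, Finset.mem_univ, if_true]
    rw [mul_smul (m.Θ i j * m.Θ k j)]
    congr 1
    rw [Algebra.smul_def, mul_one]; rfl
  rw [Matrix.add_apply, Matrix.transpose_apply, corr_apply, corr_apply, ← Matrix.trace_add,
    ← mul_add, h, mul_smul_comm, mul_one, Matrix.trace_smul, m.trace_ω, smul_eq_mul, mul_one]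
  simp only [Matrix.neg_apply, Matrix.smul_apply, Matrix.mul_apply, Matrix.transpose_apply,
    smul_eq_mul, Finset.mul_sum, ← Finset.sum_neg_distrib]
  refine Finset.sum_congr rfl fun j _ => ?_
  simp only [Θ_eq, Matrix.smul_apply, smul_eq_mul]
  linear_combination (2 * m.Wc i j * m.Wc k j) * Complex.I_mul_I

lemma interaction_mul_self : m.interaction * m.interaction =
    ∑ i, ∑ k, (m.sysV i * m.sysV k) ⊗ₖ (m.bathV i * m.bathV k) := by
  simp only [interaction_eq, Finset.sum_mul, Finset.mul_sum, ← Matrix.mul_kronecker_mul]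
  exact Finset.sum_comm

/-- The bath energy contributes the same multiple of ρ on both sides of the commutator and cancels.
-/
lemma generator_apply (ρ : Op L) :
    m.generator ρ = (-Complex.I) • (m.sysH * ρ - ρ * m.sysH) +
      ∑ i, ∑ k, m.corr i k • (m.sysV k * ρ * m.sysV i) -
      (1 / 2 : ℂ) • ∑ i, ∑ k, m.corr i k • (m.sysV i * m.sysV k * ρ + ρ * (m.sysV i * m.sysV k)) := by
  have hcyc (A : Op K) : (A * m.ω).trace = (m.ω * A).trace := Matrix.trace_mul_comm _ _
  have h1 : partialTrace ((m.systemHamiltonian + m.bathHamiltonian) * (ρ ⊗ₖ m.ω)) =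
      m.sysH * ρ + (m.ω * m.bathH).trace • ρ := by
    rw [systemHamiltonian_eq, bathHamiltonian_eq, add_mul, partialTrace_add,
      ← Matrix.mul_kronecker_mul, ← Matrix.mul_kronecker_mul, partialTrace_kronecker,
      partialTrace_kronecker, one_mul, one_mul, m.trace_ω, one_smul, hcyc]
  have h2 : partialTrace ((ρ ⊗ₖ m.ω) * (m.systemHamiltonian + m.bathHamiltonian)) =
      ρ * m.sysH + (m.ω * m.bathH).trace • ρ := by
    rw [systemHamiltonian_eq, bathHamiltonian_eq, mul_add, partialTrace_add,
      ← Matrix.mul_kronecker_mul, ← Matrix.mul_kronecker_mul, partialTrace_kronecker,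
      partialTrace_kronecker, mul_one, mul_one, m.trace_ω, one_smul]
  have h3 : partialTrace (m.interaction * m.interaction * (ρ ⊗ₖ m.ω)) =
      ∑ i, ∑ k, m.corr i k • (m.sysV i * m.sysV k * ρ) := by
    simp only [interaction_mul_self, Finset.sum_mul, partialTrace_sum, ← Matrix.mul_kronecker_mul,
      partialTrace_kronecker, hcyc, corr_apply]
  have h4 : partialTrace ((ρ ⊗ₖ m.ω) * (m.interaction * m.interaction)) =
      ∑ i, ∑ k, m.corr i k • (ρ * (m.sysV i * m.sysV k)) := by
    simp only [interaction_mul_self, Finset.mul_sum, partialTrace_sum, ← Matrix.mul_kronecker_mul,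
      partialTrace_kronecker, corr_apply]
  have h5 : partialTrace (m.interaction * (ρ ⊗ₖ m.ω) * m.interaction) =
      ∑ i, ∑ k, m.corr i k • (m.sysV k * ρ * m.sysV i) := by
    simp only [interaction_eq, Finset.sum_mul, Finset.mul_sum, partialTrace_sum,
      ← Matrix.mul_kronecker_mul, partialTrace_kronecker, corr_apply]
    refine Finset.sum_congr rfl fun i _ => Finset.sum_congr rfl fun k _ => ?_
    rw [mul_assoc, Matrix.trace_mul_comm, mul_assoc]
  have hI1 : (1 / 2 * (-Complex.I * -Complex.I) : ℂ) = -(1 / 2) := by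
    linear_combination (1 / 2) * Complex.I_mul_I
  have hI2 : (Complex.I * -Complex.I : ℂ) = 1 := by
    linear_combination -Complex.I_mul_I
  have hI3 : (1 / 2 * (Complex.I * Complex.I) : ℂ) = -(1 / 2) := by
    linear_combination (1 / 2) * Complex.I_mul_I
  simp only [generator, _root_.add_apply, sandwich_apply, one_mul, mul_one, add_mul, mul_add,
    smul_mul_assoc, mul_smul_comm, partialTrace_add, partialTrace_smul, smul_smul,
    smul_add, Finset.sum_add_distrib] at h1 h2 h3 h4 h5 ⊢
  rw [h3, h4, h5, hI1, hI2, hI3, eq_sub_of_add_eq h1, eq_sub_of_add_eq h2]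
  module

/-- The drift matrix of the dual generator. -/
noncomputable def drift : Matrix (Phase L) (Phase L) ℂ :=
  -(2 : ℂ) • m.RSc - (2 : ℂ) • (m.Wc * m.Wc.transpose)

/-- The generator of the evolution of observables. -/
noncomputable def dual : Op L →ₗ[ℂ] Op L :=
  quadOp (raising m.E) (lowering m.E) m.drift +
    quadOp (lowering m.E) (lowering m.E) ((2 : ℂ) • m.corr)

lemma sum_sum_smul_eq_zero {ι V : Type*} [Fintype ι] [AddCommGroup V] [Module ℂ V]
    (R : Matrix ι ι ℂ) (hR : R.transpose = -R) (f : ι → ι → V) (hf : ∀ i j, f i j = f j i) :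
    ∑ i, ∑ j, R i j • f i j = 0 := by
  have h : ∑ i, ∑ j, R i j • f i j = -∑ i, ∑ j, R i j • f i j := by
    refine Finset.sum_comm.trans ?_
    rw [← Finset.sum_neg_distrib]
    refine Finset.sum_congr rfl fun i _ => ?_
    rw [← Finset.sum_neg_distrib]
    refine Finset.sum_congr rfl fun j _ => ?_
    have := congrFun (congrFun hR i) j
    rw [Matrix.transpose_apply, Matrix.neg_apply] at this
    rw [this, neg_smul, hf]
  have h2 : (2 : ℂ) • ∑ i, ∑ j, R i j • f i j = 0 := by
    rw [two_smul]; exact eq_neg_iff_add_eq_zero.mp h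
  exact (smul_eq_zero.mp h2).resolve_left two_ne_zero

lemma commutator_eq_quadOp (X : Op L) :
    Complex.I • (m.sysH * X - X * m.sysH) =
      quadOp (raising m.E) (lowering m.E) (-(2 : ℂ) • m.RSc) X := by
  rw [← sub_eq_zero]
  -- Up to the factor 1/2 this is the discrepancy between the two sides; it is symmetric in i, j and
  -- so vanishes against the antisymmetric `RSc`.
  have h := sum_sum_smul_eq_zero m.RSc m.RSc_transpose
    (fun i j => X * (systemField m.E i * systemField m.E j) +
      X * (systemField m.E j * systemField m.E i) + twistedSandwich m.E i j X +
        twistedSandwich m.E j i X) (fun i j => by abel)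
  have h' := congrArg (fun Z => (1 / 2 : ℂ) • Z) h
  rw [smul_zero] at h'
  refine Eq.trans ?_ h'
  simp only [sysH, quadOp_apply, smul_mul_assoc, mul_smul_comm, Finset.sum_mul, Finset.mul_sum,
    Finset.smul_sum, smul_sub, ← Finset.sum_sub_distrib]
  refine Finset.sum_congr rfl fun i _ => Finset.sum_congr rfl fun j _ => ?_
  rw [raising_lowering, TS_eq, Matrix.smul_apply, Matrix.smul_apply, smul_eq_mul, smul_eq_mul]
  simp only [smul_smul]
  have hI : Complex.I * (1 / 2 * (Complex.I * m.RSc i j)) = -(1 / 2) * m.RSc i j := by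
    linear_combination (1 / 2 * m.RSc i j) * Complex.I_mul_I
  rw [hI]
  module

/-- Each summand splits into a raising–lowering part symmetric in i, k, which collects `corr` plus
its transpose, and a double lowering. -/
lemma dissipator_eq_quadOp (X : Op L) :
    ∑ i, ∑ k, m.corr i k • (m.sysV i * X * m.sysV k) -
      (1 / 2 : ℂ) • ∑ i, ∑ k, m.corr i k • (m.sysV i * m.sysV k * X + X * (m.sysV i * m.sysV k)) =
    quadOp (raising m.E) (lowering m.E) (m.corr + m.corr.transpose) X +
      quadOp (lowering m.E) (lowering m.E) ((2 : ℂ) • m.corr) X := by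
  have h1 (i k : Phase L) : m.sysV i * X * m.sysV k = twistedSandwich m.E i k X := rfl
  have h2 (i k : Phase L) : m.sysV i * m.sysV k = -(systemField m.E i * systemField m.E k) := by
    simp only [sysV, mul_assoc, mul_neg, parity_mul_systemField_mul,
      parity_mul_self, mul_one]
  have h3 : quadOp (raising m.E) (lowering m.E) (m.corr + m.corr.transpose) X =
      ∑ i, ∑ k, m.corr i k • (raising m.E i (lowering m.E k X) +
        raising m.E k (lowering m.E i X)) := by
    simp only [quadOp_apply, Matrix.add_apply, Matrix.transpose_apply, add_smul, smul_add,
      Finset.sum_add_distrib]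
    exact congrArg₂ (· + ·) rfl Finset.sum_comm
  have key (i k : Phase L) : m.corr i k • (m.sysV i * X * m.sysV k) - (1 / 2 : ℂ) • m.corr i k •
      (m.sysV i * m.sysV k * X + X * (m.sysV i * m.sysV k)) =
      m.corr i k • (raising m.E i (lowering m.E k X) + raising m.E k (lowering m.E i X)) +
        ((2 : ℂ) • m.corr) i k • lowering m.E i (lowering m.E k X) := by
    have h4 := systemField_mul_swap m.E k i
    simp only [eq_comm (a := k) (b := i)] at h4
    rw [h1, h2, raising_lowering, raising_lowering, lowering_lowering, Matrix.smul_apply,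
      smul_eq_mul, h4]
    simp only [sub_mul, mul_sub, smul_mul_assoc, mul_smul_comm, one_mul, mul_one, neg_mul, mul_neg]
    module
  rw [h3, quadOp_apply]
  simp only [Finset.smul_sum, ← Finset.sum_sub_distrib, ← Finset.sum_add_distrib, key]

/-- The duality between the evolutions of states and observables. -/
theorem trace_mul_generator (X ρ : Op L) :
    (X * m.generator ρ).trace = (m.dual X * ρ).trace := by
  have hd : m.dual X = Complex.I • (m.sysH * X - X * m.sysH) +
      (∑ i, ∑ k, m.corr i k • (m.sysV i * X * m.sysV k) - (1 / 2 : ℂ) •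
        ∑ i, ∑ k, m.corr i k • (m.sysV i * m.sysV k * X + X * (m.sysV i * m.sysV k))) := by
    rw [commutator_eq_quadOp, dissipator_eq_quadOp, corr_add_transpose, dual, drift,
      LinearMap.add_apply, ← add_assoc]
    congr 1
    simp only [quadOp_apply, ← Finset.sum_add_distrib, ← add_smul, sub_eq_add_neg,
      Matrix.add_apply]
  have h1 (A B : Op L) : (X * (A * ρ * B)).trace = (B * X * A * ρ).trace := by
    rw [Matrix.mul_assoc B, Matrix.mul_assoc B, Matrix.trace_mul_comm B]
    simp only [mul_assoc]
  have h2 (A : Op L) : (X * (ρ * A)).trace = (A * X * ρ).trace := by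
    rw [mul_assoc A, Matrix.trace_mul_comm A, mul_assoc]
  rw [hd, generator_apply]
  simp only [mul_add, mul_sub, add_mul, sub_mul, mul_smul_comm, smul_mul_assoc, Finset.mul_sum,
    Finset.sum_mul, Matrix.trace_add, Matrix.trace_sub, Matrix.trace_smul, Matrix.trace_sum, h1, h2,
    smul_eq_mul, Finset.sum_add_distrib]
  simp only [← mul_assoc]
  ring

end Model

end Dual

lemma exp_add_smul_apply {E : Type*} [NormedAddCommGroup E] [NormedSpace ℂ E] [CompleteSpace E]
    (A : E →L[ℂ] E) (s t : ℂ) (v : E) :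
    NormedSpace.exp ((s + t) • A) v = NormedSpace.exp (s • A) (NormedSpace.exp (t • A) v) := by
  have : NormedAlgebra ℚ (E →L[ℂ] E) := NormedAlgebra.restrictScalars ℚ ℂ _
  rw [add_smul, NormedSpace.exp_add_of_commute
    (((Commute.refl A).smul_left _).smul_right _), mul_apply_eq_comp]

/-! ### Convergence to stationary states -/

section Main

open scoped Matrix.Norms.L2Operator

variable {L K : ℕ}

/-- Write ρ = B*B: the entries are inner products of columns of B, whose squared norms sum to the
trace. -/
lemma IsState.norm_apply_le_one {n : ℕ} {ρ : Op n} (h : IsState ρ) (i j : Finset (Fin n)) :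
    ‖ρ i j‖ ≤ 1 := by
  obtain ⟨B, rfl⟩ : ∃ B : Op n, ρ = B.conjTranspose * B := by
    open scoped MatrixOrder in
    exact CStarAlgebra.nonneg_iff_eq_star_mul_self.mp (Matrix.nonneg_iff_posSemidef.mpr h.1)
  have htr : ∑ j, ∑ k, ‖B k j‖ ^ 2 = 1 := by
    have := congrArg Complex.re h.2
    simp only [Matrix.trace, Matrix.diag, Matrix.mul_apply, Matrix.conjTranspose_apply,
      Complex.re_sum, Complex.one_re] at this
    rw [← this]
    refine Finset.sum_congr rfl fun j _ => Finset.sum_congr rfl fun k _ => ?_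
    rw [← starRingEnd_apply, ← Complex.normSq_eq_conj_mul_self, Complex.ofReal_re,
      Complex.normSq_eq_norm_sq]
  have hcol (j : Finset (Fin n)) : ∑ k, ‖B k j‖ ^ 2 ≤ 1 := by
    rw [← htr]
    exact Finset.single_le_sum (f := fun j => ∑ k, ‖B k j‖ ^ 2) (fun j _ => by positivity)
      (Finset.mem_univ j)
  calc ‖(B.conjTranspose * B) i j‖ ≤ ∑ k, ‖B k i‖ * ‖B k j‖ := by
        rw [Matrix.mul_apply]
        refine (norm_sum_le _ _).trans_eq (Finset.sum_congr rfl fun k _ => ?_)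
        rw [norm_mul, Matrix.conjTranspose_apply, norm_star]
    _ ≤ ∑ k, (1 / 2 * ‖B k i‖ ^ 2 + 1 / 2 * ‖B k j‖ ^ 2) :=
        Finset.sum_le_sum fun k _ => by nlinarith [sq_nonneg (‖B k i‖ - ‖B k j‖)]
    _ = 1 / 2 * ∑ k, ‖B k i‖ ^ 2 + 1 / 2 * ∑ k, ‖B k j‖ ^ 2 := by
        rw [Finset.sum_add_distrib, Finset.mul_sum, Finset.mul_sum]
    _ ≤ 1 := by linarith [hcol i, hcol j]

lemma IsState.exists_norm_le (n : ℕ) : ∃ B : ℝ, ∀ ρ : Op n, IsState ρ → ‖ρ‖ ≤ B := by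
  refine ⟨∑ i : Finset (Fin n), ∑ j : Finset (Fin n), ‖(Matrix.single i j (1 : ℂ) : Op n)‖,
    fun ρ h => ?_⟩
  conv_lhs => rw [Matrix.matrix_eq_sum_single ρ]
  refine (norm_sum_le _ _).trans (Finset.sum_le_sum fun i _ => (norm_sum_le _ _).trans
    (Finset.sum_le_sum fun j _ => ?_))
  have : (Matrix.single i j (ρ i j) : Op n) = ρ i j • Matrix.single i j (1 : ℂ) := by
    rw [Matrix.smul_single, smul_eq_mul, mul_one]
  rw [this, norm_smul]
  exact mul_le_of_le_one_left (norm_nonneg _) (h.norm_apply_le_one i j)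

/-- A subspace containing all states is everything. -/
lemma eq_top_of_isState_mem {n : ℕ} (S : Submodule ℂ (Op n)) (hS : ∀ ρ, IsState ρ → ρ ∈ S) :
    S = ⊤ := by
  open scoped MatrixOrder in
  rw [eq_top_iff, ← CStarAlgebra.span_nonneg (A := Op n), Submodule.span_le]
  intro A hA
  have hA' : A.PosSemidef := by
    open scoped MatrixOrder in
    exact Matrix.nonneg_iff_posSemidef.mp hA
  by_cases h0 : A.trace = 0
  · rw [hA'.trace_eq_zero_iff.mp h0]
    exact S.zero_mem
  · have h1 : IsState (A.trace⁻¹ • A) :=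
      ⟨hA'.smul (inv_nonneg.mpr hA'.trace_nonneg), by
        rw [Matrix.trace_smul, smul_eq_mul, inv_mul_cancel₀ h0]⟩
    have h2 := S.smul_mem A.trace (hS _ h1)
    rwa [smul_smul, mul_inv_cancel₀ h0, one_smul] at h2

namespace Model

variable (m : Model L K)

/-- The operator `∑ xᵢ αᵢ`. -/
noncomputable def field (x : Phase L → ℂ) : Op L := ∑ i, x i • systemField m.E i

/-- Lowering reads off coefficients, so x is determined by its field. -/
lemma lowering_field (x : Phase L → ℂ) (j : Phase L) :
    lowering m.E j (m.field x) = x j • (1 : Op L) := by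
  have h (i : Phase L) : lowering m.E j (systemField m.E i) =
      if j = i then (1 : Op L) else 0 := by
    have h1 : parity L * systemField m.E i * (parity L * systemField m.E j) =
        -(systemField m.E i * systemField m.E j) := by
      rw [parity_mul_systemField, neg_mul, mul_assoc, parity_mul_parity_mul]
    rw [lowering_apply, h1, sub_neg_eq_add, systemField_car]
    split_ifs
    · have : (2 : Op L) = (2 : ℂ) • (1 : Op L) := by rw [Algebra.smul_def, mul_one]; rfl
      rw [this, smul_smul]
      norm_num
    · simp
  simp only [field, map_sum, map_smul, h, smul_ite, smul_zero, Finset.sum_ite_eq, Finset.mem_univ,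
    if_true]

lemma raising_one (i : Phase L) : raising m.E i 1 = systemField m.E i := by
  rw [raising_apply, mul_one, mul_one, parity_mul_parity_mul, ← two_smul ℂ, smul_smul]
  norm_num

lemma lowering_one (i : Phase L) : lowering m.E i 1 = 0 := by
  rw [lowering_apply, mul_one, mul_one, parity_mul_parity_mul, sub_self, smul_zero]

/-- Fields have degree one: a double lowering kills them, and only the drift acts. -/
lemma dual_field (x : Phase L → ℂ) : m.dual (m.field x) = m.field (m.drift.mulVec x) := by
  rw [dual, LinearMap.add_apply, quadOp_apply, quadOp_apply]
  simp only [lowering_field, map_smul, raising_one, lowering_one, smul_zero,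
    Finset.sum_const_zero, add_zero, smul_smul]
  simp only [field, Matrix.mulVec, dotProduct, Finset.sum_smul]

/-- Linear functionals from undamped eigenvectors evolve by a phase. -/
lemma trace_field_semigroup {x : Phase L → ℂ} {c : ℂ} (hx : m.drift.mulVec x = c • x) (t : ℝ)
    (ρ : Op L) : (m.field x * m.semigroup t ρ).trace =
      Complex.exp (t * c) * (m.field x * ρ).trace := by
  let f : Op L →L[ℂ] ℂ := LinearMap.toContinuousLinearMap
    (Matrix.traceLinearMap (Finset (Fin L)) ℂ ℂ ∘ₗ LinearMap.mulLeft ℂ (m.field x))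
  have hf (v : Op L) : f v = (m.field x * v).trace := rfl
  rw [← hf, ← hf]
  refine apply_exp_smul_of_eigen m.generator f c (fun v => ?_) t ρ
  have hsm : m.field (c • x) = c • m.field x := by
    simp only [field, Pi.smul_apply, smul_eq_mul, mul_smul, Finset.smul_sum]
  rw [hf, hf, trace_mul_generator, dual_field, hx, hsm, smul_mul_assoc, Matrix.trace_smul,
    smul_eq_mul]

/-- An undamped rotating mode prevents convergence. -/
theorem eq_zero_of_convergence
    (h : ∀ ρ : Op L, IsState ρ → ∃ σ : Op L, IsStationaryState m.semigroup σ ∧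
      Filter.Tendsto (fun t => m.semigroup t ρ) Filter.atTop (𝓝 σ))
    {μ : ℂ} (hμ : Module.End.eigenspace m.opTS μ ⊓ m.kerΘstar ≠ ⊥) : μ = 0 := by
  obtain ⟨x, ⟨hx1, hx2⟩, hx0⟩ := Submodule.exists_mem_ne_zero_of_ne_bot hμ
  rw [SetLike.mem_coe, Module.End.mem_eigenspace_iff] at hx1
  rw [SetLike.mem_coe, mem_kerΘstar] at hx2
  by_contra hμ0
  have hreal : (starRingEnd ℂ) μ = μ :=
    m.opTS_isSymmetric.conj_eigenvalue_eq_self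
      (Module.End.hasEigenvalue_of_hasEigenvector ⟨Module.End.mem_eigenspace_iff.mpr hx1, hx0⟩)
  -- On ker Θ* the drift is -2 `RSc`, and `RSc` acts on x as -iμ.
  set c : ℂ := 2 * Complex.I * μ with hc
  have hdrift : m.drift.mulVec x.ofLp = c • x.ofLp := by
    have h1 : m.RSc.mulVec x.ofLp = (-Complex.I * μ) • x.ofLp := by
      have := congrArg WithLp.ofLp hx1
      rw [opTS_apply, TS_eq, Matrix.smul_mulVec] at this
      have := congrArg ((-Complex.I) • ·) this
      simpa [smul_smul] using this
    rw [drift, Matrix.sub_mulVec, Matrix.smul_mulVec, Matrix.smul_mulVec, ← Matrix.mulVec_mulVec,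
      hx2, h1, Matrix.mulVec_zero, smul_zero, sub_zero, smul_smul, hc]
    congr 1
    ring
  have hcre : c.re = 0 := by
    have := Complex.conj_eq_iff_im.mp hreal
    simp [hc, this]
  have hc0 : c ≠ 0 := by simp [hc, hμ0]
  have hzero (ρ : Op L) (hρ : IsState ρ) : (m.field x.ofLp * ρ).trace = 0 := by
    obtain ⟨σ, hσ, hlim⟩ := h ρ hρ
    have hσ0 : (m.field x.ofLp * σ).trace = 0 := by
      -- Half a period: the phase is -1, so a stationary state gives the field expectation 0.
      set t : ℝ := Real.pi / ‖c‖ with ht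
      have h1 := m.trace_field_semigroup hdrift t σ
      rw [hσ.2 t (by positivity)] at h1
      have h2 : Complex.exp (t * c) = -1 := by
        have hcim : c = (c.im : ℂ) * Complex.I := by
          apply Complex.ext <;> simp [hcre]
        have hn : ‖c‖ = |c.im| := by
          conv_lhs => rw [hcim]
          simp
        have him : c.im ≠ 0 := fun h0 => hc0 (Complex.ext hcre h0)
        rcases lt_or_gt_of_ne him with hneg | hpos
        · have : (t : ℂ) * c = -(Real.pi * Complex.I) := by
            rw [hcim, ht, hn, abs_of_neg hneg]
            push_cast
            have : (c.im : ℂ) ≠ 0 := by exact_mod_cast him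
            field_simp
          rw [this, Complex.exp_neg, Complex.exp_pi_mul_I]
          norm_num
        · have : (t : ℂ) * c = Real.pi * Complex.I := by
            rw [hcim, ht, hn, abs_of_pos hpos]
            push_cast
            have : (c.im : ℂ) ≠ 0 := by exact_mod_cast him
            field_simp
          rw [this, Complex.exp_pi_mul_I]
      rw [h2, neg_one_mul] at h1
      exact self_eq_neg.mp h1
    -- The modulus of the expectation is constant along the orbit, so it equals its limiting value
    -- 0.
    have hcont : Continuous fun A : Op L => ‖(m.field x.ofLp * A).trace‖ := by fun_prop
    have hlim2 := (hcont.tendsto σ).comp hlim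
    have hconst : (fun A : Op L => ‖(m.field x.ofLp * A).trace‖) ∘ (fun t => m.semigroup t ρ) =
        fun _ => ‖(m.field x.ofLp * ρ).trace‖ := by
      funext t
      simp only [Function.comp, m.trace_field_semigroup hdrift, norm_mul, Complex.norm_exp]
      simp [hcre]
    rw [hconst, hσ0, norm_zero] at hlim2
    exact norm_eq_zero.mp (tendsto_nhds_unique tendsto_const_nhds hlim2)
  -- States span all operators, so the field is trace-orthogonal to everything, in particular to its
  -- own adjoint.
  let S : Submodule ℂ (Op L) := LinearMap.ker
    (Matrix.traceLinearMap (Finset (Fin L)) ℂ ℂ ∘ₗ LinearMap.mulLeft ℂ (m.field x.ofLp))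
  have hS : S = ⊤ := eq_top_of_isState_mem S fun ρ hρ => hzero ρ hρ
  have hfield : m.field x.ofLp = 0 := by
    have h1 : (m.field x.ofLp).conjTranspose ∈ S := hS ▸ Submodule.mem_top
    exact Matrix.trace_mul_conjTranspose_self_eq_zero_iff.mp h1
  refine hx0 (PiLp.ext fun j => ?_)
  have h1 := m.lowering_field x.ofLp j
  rw [hfield, map_zero] at h1
  exact (smul_eq_zero.mp h1.symm).resolve_right one_ne_zero

/-- The trace pairing is bilinear, so c passes to the dual unconjugated: were `dual` - c injective,
it would reach ρ*, and duality would give tr(ρ*ρ) = 0. -/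
lemma generator_eigenvalue_eq_zero
    (h : ∃ μ : ℂ, m.kalmanSpaceᗮ ≤ Module.End.eigenspace m.opTS μ) {c : ℂ} {ρ : Op L}
    (hρ0 : ρ ≠ 0) (hρ : m.generator ρ = c • ρ) (hc : c.re = 0) : c = 0 := by
  have hinj : ¬Function.Injective (m.dual - c • (1 : Module.End ℂ (Op L))) := by
    intro hinj
    obtain ⟨X, hX⟩ := LinearMap.injective_iff_surjective.mp hinj ρ.conjTranspose
    have h1 : (ρ.conjTranspose * ρ).trace = 0 := by
      have h2 : m.dual X - c • X = ρ.conjTranspose := hX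
      rw [← h2, sub_mul, Matrix.trace_sub, ← trace_mul_generator, hρ, mul_smul_comm, smul_mul_assoc,
        sub_self]
    exact hρ0 (Matrix.trace_conjTranspose_mul_self_eq_zero_iff.mp h1)
  rw [← LinearMap.ker_eq_bot] at hinj
  obtain ⟨X, hX, hX0⟩ := Submodule.exists_mem_ne_zero_of_ne_bot hinj
  have hX' : m.dual X - c • X = 0 := hX
  exact quadOp_eigenvalue_eq_zero m.E m.RSc_conjTranspose m.Wc_conjTranspose
    (m.RSc_mulVec_eq_zero h) ((2 : ℂ) • m.corr) hc hX0 (sub_eq_zero.mp hX')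

/-- States remain states and are uniformly bounded; since they span, every orbit is bounded. -/
lemma exists_bound_semigroup (v : Op L) : ∃ B, ∀ t : ℝ, 0 ≤ t → ‖m.semigroup t v‖ ≤ B := by
  let S : Submodule ℂ (Op L) :=
    { carrier := {v | ∃ B, ∀ t : ℝ, 0 ≤ t → ‖m.semigroup t v‖ ≤ B}
      add_mem' := by
        rintro a b ⟨B, hB⟩ ⟨B', hB'⟩
        refine ⟨B + B', fun t ht => ?_⟩
        rw [semigroup, map_add]
        exact (norm_add_le _ _).trans (add_le_add (hB t ht) (hB' t ht))
      zero_mem' := ⟨0, fun t _ => by rw [semigroup, map_zero, norm_zero]⟩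
      smul_mem' := by
        rintro c a ⟨B, hB⟩
        refine ⟨‖c‖ * B, fun t ht => ?_⟩
        rw [semigroup, map_smul, norm_smul]
        exact mul_le_mul_of_nonneg_left (hB t ht) (norm_nonneg _) }
  have hS : S = ⊤ := eq_top_of_isState_mem S fun ρ hρ => by
    obtain ⟨B, hB⟩ := IsState.exists_norm_le L
    exact ⟨B, fun t ht => hB _ (m.semigroup_isState ht hρ)⟩
  have : v ∈ S := hS ▸ Submodule.mem_top
  exact this

lemma semigroup_add (s t : ℝ) (ρ : Op L) :
    m.semigroup (s + t) ρ = m.semigroup s (m.semigroup t ρ) := by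
  rw [semigroup, Complex.ofReal_add]
  exact exp_add_smul_apply m.generator s t ρ

theorem exists_stationary_limit (h : ∃ μ : ℂ, m.kalmanSpaceᗮ ≤ Module.End.eigenspace m.opTS μ)
    {ρ : Op L} (hρ : IsState ρ) : ∃ σ : Op L, IsStationaryState m.semigroup σ ∧
      Filter.Tendsto (fun t => m.semigroup t ρ) Filter.atTop (𝓝 σ) := by
  obtain ⟨σ, hσ⟩ := tendsto_exp_of_bounded m.generator m.exists_bound_semigroup
    (fun c v hv hv' hc => m.generator_eigenvalue_eq_zero h hv hv' hc) ρ
  refine ⟨σ, ⟨isClosed_setOf_isState.mem_of_tendsto hσ ?_, fun t ht => ?_⟩, hσ⟩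
  · filter_upwards [Filter.eventually_ge_atTop 0] with t ht
    exact m.semigroup_isState ht hρ
  · have h1 := ((NormedSpace.exp ((t : ℂ) • m.generator)).continuous.tendsto σ).comp hσ
    have h2 : Filter.Tendsto (fun s => m.semigroup (t + s) ρ) Filter.atTop (𝓝 σ) :=
      hσ.comp (Filter.tendsto_atTop_add_const_left _ t Filter.tendsto_id)
    refine tendsto_nhds_unique (h1.congr fun s => ?_) h2
    exact (m.semigroup_add t s ρ).symm

end Model

end Main

end FermionicRI

theorem mainTheorem4 (L K : ℕ) (m : Model L K) :
    (∃ Λ : ℝ → Op L → Op L, m.IsContinuousTimeLimit Λ) ∧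
    ∀ Λ : ℝ → Op L → Op L, m.IsContinuousTimeLimit Λ →
      List.TFAE [
        -- every initial state converges to some stationary state
        ∀ ρ : Op L, IsState ρ →
          ∃ σ : Op L, IsStationaryState Λ σ ∧ Filter.Tendsto (fun t => Λ t ρ) Filter.atTop (𝓝 σ),
        -- at most one eigenvalue of `T_S` has an eigenvector in `ker Θ*`
        {μ : ℂ | Module.End.eigenspace m.opTS μ ⊓ m.kerΘstar ≠ ⊥}.Subsingleton,
        -- the orthogonal complement of `V(T_S, Θ)` lies in a single eigenspace of `T_S`
        ∃ μ : ℂ, m.kalmanSpaceᗮ ≤ Module.End.eigenspace m.opTS μ] := by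
  refine ⟨⟨m.semigroup, m.isContinuousTimeLimit_semigroup⟩, fun Λ hΛ => ?_⟩
  -- Λ is determined only for t ≥ 0, which is all that stationarity and limits at infinity use.
  have hstat (σ : Op L) : IsStationaryState Λ σ ↔ IsStationaryState m.semigroup σ :=
    and_congr_right fun _ => forall₂_congr fun t ht => by rw [hΛ.eq_semigroup m ht]
  have hconv (ρ σ : Op L) : Filter.Tendsto (fun t => Λ t ρ) Filter.atTop (𝓝 σ) ↔
      Filter.Tendsto (fun t => m.semigroup t ρ) Filter.atTop (𝓝 σ) := by
    refine Filter.tendsto_congr' ?_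
    filter_upwards [Filter.eventually_ge_atTop 0] with t ht
    exact hΛ.eq_semigroup m ht ρ
  simp only [hstat, hconv]
  tfae_have 1 → 2 := fun h μ hμ ν hν =>
    (m.eq_zero_of_convergence h hμ).trans (m.eq_zero_of_convergence h hν).symm
  tfae_have 2 ↔ 3 := m.subsingleton_iff_kalmanSpace_orthogonal_le
  tfae_have 3 → 1 := fun h ρ hρ => m.exists_stationary_limit h hρ
  tfae_finish
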